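/- Let $k$ be a commutative artinian ring, $\Gamma$ an Artin $k$-algebra (a $k$-algebra that is finitely generated as a $k$-module), and $M$ a non-zero $\Gamma$-bimodule on which $k$ acts centrally, making it a finitely generated $k$-module. Let $\theta\colon M\otimes_\Gamma M\to M$ be an associative $\Gamma$-bimodule homomorphism, i.e. $\theta\circ(\theta\otimes 1_M)=\theta\circ(1_M\otimes\theta)$; such a pair $(M,\theta)$ is called a multiplicative bimodule. Let $E=\Gamma\ltimes_\theta M$ be the ring $\Gamma\oplus M$ with multiplication $(\gamma_1,m_1)(\gamma_2,m_2)=(\gamma_1\gamma_2,\ \gamma_1m_2+m_1\gamma_2+\theta(m_1\otimes m_2))$, and let $\widetilde M=0\oplus M$, an ideal of $E$. Call $M$ tensor nilpotent if $M^{\otimes_\Gamma i}=0$ for some $i>1$. Call $M$ right perfect if $\operatorname{Tor}^\Gamma_i(M^{\otimes_\Gamma j},M)=0$ for all $i,j\ge 1$ and $\operatorname{pd} M_\Gamma<\infty$; left perfect if $\operatorname{Tor}^\Gamma_i(M,M^{\otimes_\Gamma j})=0$ for all $i,j\ge 1$ and $\operatorname{pd}{}_\Gamma M<\infty$; and perfect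 if it is left and right perfect. Call $(M,\theta)$ nilpotent if $\theta^N=0$ for some $N\geq 1$, where $\theta^0=\mathrm{id}_M$ and $\theta^{r}=\theta\circ(\theta^{r-1}\otimes 1_M)\colon M^{\otimes_\Gamma(r+1)}\to M$ for $r\ge 1$. Call $(M,\theta)$ removable if it is nilpotent and either both $\operatorname{pd}\widetilde M_E$ and $\operatorname{pd}{}_E\widetilde M$ are finite, or $\operatorname{pd}\widetilde M_E$ is finite, $\operatorname{pd}{}_E\widetilde M$ is infinite and $\theta=0$. For a ring $R$, let $\operatorname{gd}R$ be the supremum of the projective dimensions of all left $R$-modules, $\operatorname{Fpd}R$ the supremum over all left $R$-modules of finite projective dimension, and $\operatorname{fpd}R$ the supremum over all finitely generated left $R$-modules of finite projective dimension. Theorem. Assume that $M$ is tensor nilpotent and that either (i) $M$ is perfect over $\Gamma$, or (ii) $M$ is right perfect over $\Gamma$ and $\theta=0$. Then $(M,\theta)$ is removable. Moreover, $$\operatorname{fpd}(\Gamma\ltimes_\theta M)<\infty\iff\operatorname{fpd}\Gamma<\infty,$$ and likewise $\operatorname{Fpd}(\Gamma\ltimes_\theta M)<\infty\iff\operatorname{Fpd}\Gamma<\infty$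 and $\operatorname{gd}(\Gamma\ltimes_\theta M)<\infty\iff\operatorname{gd}\Gamma<\infty$. -/

import Mathlib

open CategoryTheory MulOpposite

universe v u

/-! Right `Γ`-modules are modules over `Γᵐᵒᵖ`, with `x · γ = op γ • x`.  A `Γ`-bimodule is an
additive group with commuting `Γ`- and `Γᵐᵒᵖ`-module structures. -/

/-! ### Tensor products over a noncommutative ring -/

section Tensor

variable (Γ : Type u) [Ring Γ]

/-- The subgroup of `X ⊗[ℤ] Y` generated by all `(x · γ) ⊗ y - x ⊗ (γ · y)`. -/
def balancedRel (X Y : Type u) [AddCommGroup X] [Module Γᵐᵒᵖ X] [AddCommGroup Y] [Module Γ Y] :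
    AddSubgroup (TensorProduct ℤ X Y) :=
  AddSubgroup.closure {t | ∃ (x : X) (γ : Γ) (y : Y),
    t = TensorProduct.tmul ℤ (op γ • x) y - TensorProduct.tmul ℤ x (γ • y)}

/-- The tensor product `X ⊗_Γ Y` of a right `Γ`-module `X` and a left `Γ`-module `Y`. -/
def RTensor (X Y : Type u) [AddCommGroup X] [Module Γᵐᵒᵖ X] [AddCommGroup Y] [Module Γ Y] :
    Type u :=
  TensorProduct ℤ X Y ⧸ balancedRel Γ X Y

namespace RTensor

section

variable {X Y X' Y' X'' Y'' : Type u}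
  [AddCommGroup X] [Module Γᵐᵒᵖ X] [AddCommGroup Y] [Module Γ Y]
  [AddCommGroup X'] [Module Γᵐᵒᵖ X'] [AddCommGroup Y'] [Module Γ Y']
  [AddCommGroup X''] [Module Γᵐᵒᵖ X''] [AddCommGroup Y''] [Module Γ Y'']

instance : AddCommGroup (RTensor Γ X Y) :=
  inferInstanceAs (AddCommGroup (TensorProduct ℤ X Y ⧸ balancedRel Γ X Y))

/-- The quotient map `X ⊗[ℤ] Y → X ⊗_Γ Y`. -/
def mk : TensorProduct ℤ X Y →+ RTensor Γ X Y := QuotientAddGroup.mk' (balancedRel Γ X Y)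

/-- The elementary tensor `x ⊗ y`. -/
def tmul (x : X) (y : Y) : RTensor Γ X Y := mk Γ (TensorProduct.tmul ℤ x y)

theorem smul_tmul (x : X) (γ : Γ) (y : Y) : tmul Γ (op γ • x) y = tmul Γ x (γ • y) := by
  have h : TensorProduct.tmul ℤ (op γ • x) y - TensorProduct.tmul ℤ x (γ • y) ∈
      balancedRel Γ X Y := AddSubgroup.subset_closure ⟨x, γ, y, rfl⟩
  have h' : mk Γ (TensorProduct.tmul ℤ (op γ • x) y - TensorProduct.tmul ℤ x (γ • y)) = 0 :=
    (QuotientAddGroup.eq_zero_iff _).2 h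
  rw [map_sub] at h'
  exact sub_eq_zero.1 h'

theorem add_tmul (x x' : X) (y : Y) : tmul Γ (x + x') y = tmul Γ x y + tmul Γ x' y := by
  simp only [tmul, TensorProduct.add_tmul, map_add]

theorem tmul_add (x : X) (y y' : Y) : tmul Γ x (y + y') = tmul Γ x y + tmul Γ x y' := by
  simp only [tmul, TensorProduct.tmul_add, map_add]

@[simp] theorem zero_tmul (y : Y) : tmul Γ (0 : X) y = 0 := by
  simp only [tmul, TensorProduct.zero_tmul, map_zero]

@[simp] theorem tmul_zero (x : X) : tmul Γ x (0 : Y) = 0 := by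
  simp only [tmul, TensorProduct.tmul_zero, map_zero]

theorem hom_ext {A : Type*} [AddCommGroup A] {f g : RTensor Γ X Y →+ A}
    (h : ∀ x y, f (tmul Γ x y) = g (tmul Γ x y)) : f = g := by
  have h' : f.comp (mk Γ) = g.comp (mk Γ) :=
    AddMonoidHom.toIntLinearMap_injective (TensorProduct.ext' fun x y => h x y)
  exact QuotientAddGroup.addMonoidHom_ext _ h'

/-- The additive map `f ⊗ g : X ⊗_Γ Y → X' ⊗_Γ Y'`. -/
def map (f : X →ₗ[Γᵐᵒᵖ] X') (g : Y →ₗ[Γ] Y') : RTensor Γ X Y →+ RTensor Γ X' Y' :=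
  QuotientAddGroup.map (balancedRel Γ X Y) (balancedRel Γ X' Y')
    (TensorProduct.map f.toAddMonoidHom.toIntLinearMap
      g.toAddMonoidHom.toIntLinearMap).toAddMonoidHom (by
      rw [balancedRel, AddSubgroup.closure_le]
      rintro _ ⟨x, γ, y, rfl⟩
      refine AddSubgroup.subset_closure ⟨f x, γ, g y, ?_⟩
      simp)

@[simp] theorem map_tmul (f : X →ₗ[Γᵐᵒᵖ] X') (g : Y →ₗ[Γ] Y') (x : X) (y : Y) :
    map Γ f g (tmul Γ x y) = tmul Γ (f x) (g y) := rfl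

theorem map_id : map Γ (LinearMap.id : X →ₗ[Γᵐᵒᵖ] X) (LinearMap.id : Y →ₗ[Γ] Y) =
    AddMonoidHom.id _ := hom_ext Γ fun _ _ => rfl

theorem map_comp (f' : X' →ₗ[Γᵐᵒᵖ] X'') (g' : Y' →ₗ[Γ] Y'') (f : X →ₗ[Γᵐᵒᵖ] X')
    (g : Y →ₗ[Γ] Y') :
    map Γ (f' ∘ₗ f) (g' ∘ₗ g) = (map Γ f' g').comp (map Γ f g) := hom_ext Γ fun _ _ => rfl

theorem map_add_left (f f' : X →ₗ[Γᵐᵒᵖ] X') (g : Y →ₗ[Γ] Y') :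
    map Γ (f + f') g = map Γ f g + map Γ f' g :=
  hom_ext Γ fun x y => add_tmul Γ (f x) (f' x) (g y)

theorem map_add_right (f : X →ₗ[Γᵐᵒᵖ] X') (g g' : Y →ₗ[Γ] Y') :
    map Γ f (g + g') = map Γ f g + map Γ f g' :=
  hom_ext Γ fun x y => tmul_add Γ (f x) (g y) (g' y)

theorem map_zero_left (g : Y →ₗ[Γ] Y') : map Γ (0 : X →ₗ[Γᵐᵒᵖ] X') g = 0 :=
  hom_ext Γ fun _ y => zero_tmul Γ (g y)

theorem map_zero_right (f : X →ₗ[Γᵐᵒᵖ] X') : map Γ f (0 : Y →ₗ[Γ] Y') = 0 :=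
  hom_ext Γ fun x _ => tmul_zero Γ (f x)

end

section Actions

variable {X Y X' : Type u}
  [AddCommGroup X] [Module Γᵐᵒᵖ X] [AddCommGroup Y] [Module Γ Y]
  [AddCommGroup X'] [Module Γᵐᵒᵖ X']

/-- The action of `Γ` on `X ⊗_Γ Y` from the left, if `X` is a bimodule, as a ring homomorphism. -/
def leftAction [Module Γ X] [SMulCommClass Γ Γᵐᵒᵖ X] : Γ →+* AddMonoid.End (RTensor Γ X Y) where
  toFun γ := map Γ (Module.toModuleEnd Γᵐᵒᵖ X γ) LinearMap.id
  map_one' := hom_ext Γ fun x y => congrArg (tmul Γ · y) (one_smul Γ x)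
  map_mul' a b := hom_ext Γ fun x y => congrArg (tmul Γ · y) (mul_smul a b x)
  map_zero' := hom_ext Γ fun x y =>
    (congrArg (tmul Γ · y) (zero_smul Γ x)).trans (zero_tmul Γ y)
  map_add' a b := hom_ext Γ fun x y =>
    (congrArg (tmul Γ · y) (add_smul a b x)).trans (add_tmul Γ (a • x) (b • x) y)

/-- The action of `Γ` on `X ⊗_Γ Y` from the right, if `Y` is a bimodule, as a ring
homomorphism. -/
def rightAction [Module Γᵐᵒᵖ Y] [SMulCommClass Γ Γᵐᵒᵖ Y] :
    Γᵐᵒᵖ →+* AddMonoid.End (RTensor Γ X Y) :=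
  haveI : SMulCommClass Γᵐᵒᵖ Γ Y := SMulCommClass.symm _ _ _
  { toFun := fun γ => map Γ LinearMap.id (Module.toModuleEnd Γ Y γ)
    map_one' := hom_ext Γ fun x y => congrArg (tmul Γ x) (one_smul Γᵐᵒᵖ y)
    map_mul' := fun a b => hom_ext Γ fun x y => congrArg (tmul Γ x) (mul_smul a b y)
    map_zero' := hom_ext Γ fun x y =>
      (congrArg (tmul Γ x) (zero_smul Γᵐᵒᵖ y)).trans (tmul_zero Γ x)
    map_add' := fun a b => hom_ext Γ fun x y =>
      (congrArg (tmul Γ x) (add_smul a b y)).trans (tmul_add Γ x (a • y) (b • y)) }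

instance leftModule [Module Γ X] [SMulCommClass Γ Γᵐᵒᵖ X] : Module Γ (RTensor Γ X Y) :=
  Module.compHom _ (leftAction Γ (X := X) (Y := Y))

instance rightModule [Module Γᵐᵒᵖ Y] [SMulCommClass Γ Γᵐᵒᵖ Y] : Module Γᵐᵒᵖ (RTensor Γ X Y) :=
  Module.compHom _ (rightAction Γ (X := X) (Y := Y))

@[simp] theorem left_smul_tmul [Module Γ X] [SMulCommClass Γ Γᵐᵒᵖ X] (γ : Γ) (x : X) (y : Y) :
    γ • tmul Γ x y = tmul Γ (γ • x) y := rfl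

@[simp] theorem right_smul_tmul [Module Γᵐᵒᵖ Y] [SMulCommClass Γ Γᵐᵒᵖ Y] (γ : Γᵐᵒᵖ) (x : X)
    (y : Y) : γ • tmul Γ x y = tmul Γ x (γ • y) := rfl

instance smulCommClass [Module Γ X] [SMulCommClass Γ Γᵐᵒᵖ X]
    [Module Γᵐᵒᵖ Y] [SMulCommClass Γ Γᵐᵒᵖ Y] : SMulCommClass Γ Γᵐᵒᵖ (RTensor Γ X Y) where
  smul_comm a b t := by
    have h : leftAction Γ (X := X) (Y := Y) a * rightAction Γ (X := X) (Y := Y) b =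
        rightAction Γ (X := X) (Y := Y) b * leftAction Γ (X := X) (Y := Y) a :=
      hom_ext Γ fun _ _ => rfl
    exact DFunLike.congr_fun h t

/-- `f ⊗ 1_Y : X ⊗_Γ Y → X' ⊗_Γ Y` as a homomorphism of right modules, for a bimodule `Y`. -/
def rTensorMap [Module Γᵐᵒᵖ Y] [SMulCommClass Γ Γᵐᵒᵖ Y] (f : X →ₗ[Γᵐᵒᵖ] X') :
    RTensor Γ X Y →ₗ[Γᵐᵒᵖ] RTensor Γ X' Y where
  toFun := map Γ f LinearMap.id
  map_add' := map_add _
  map_smul' γ t := by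
    have h : (map Γ f LinearMap.id).comp (rightAction Γ (X := X) (Y := Y) γ) =
        AddMonoidHom.comp (rightAction Γ (X := X') (Y := Y) γ) (map Γ f LinearMap.id) :=
      hom_ext Γ fun _ _ => rfl
    exact DFunLike.congr_fun h t

end Actions

end RTensor

/-! ### Tor -/

/-- The functor `- ⊗_Γ Y` from right `Γ`-modules to abelian groups. -/
def tensorFunctor (Y : Type u) [AddCommGroup Y] [Module Γ Y] :
    ModuleCat.{u} Γᵐᵒᵖ ⥤ AddCommGrpCat.{u} where
  obj X := AddCommGrpCat.of (RTensor Γ X Y)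
  map f := AddCommGrpCat.ofHom (RTensor.map Γ f.hom LinearMap.id)
  map_id _ := AddCommGrpCat.hom_ext (RTensor.hom_ext Γ fun _ _ => rfl)
  map_comp _ _ := AddCommGrpCat.hom_ext (RTensor.hom_ext Γ fun _ _ => rfl)

instance (Y : Type u) [AddCommGroup Y] [Module Γ Y] : (tensorFunctor Γ Y).Additive where
  map_add {_ _ f g} :=
    AddCommGrpCat.hom_ext (RTensor.map_add_left Γ f.hom g.hom LinearMap.id)

/-- `Tor_i^Γ(X, Y)` for a right `Γ`-module `X` and a left `Γ`-module `Y`. -/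
noncomputable def TorGroup (i : ℕ) (X Y : Type u) [AddCommGroup X] [Module Γᵐᵒᵖ X]
    [AddCommGroup Y] [Module Γ Y] : AddCommGrpCat.{u} :=
  ((tensorFunctor Γ Y).leftDerived i).obj (ModuleCat.of Γᵐᵒᵖ X)

end Tensor

/-! ### Homological dimensions -/

/-- The little finitistic dimension of `R` (left modules). -/
noncomputable def littleFinitisticDim (R : Type u) [Ring R] : WithBot ℕ∞ :=
  ⨆ (X : ModuleCat.{u} R) (_ : Module.Finite R X) (_ : projectiveDimension X < ⊤),
    projectiveDimension X

/-- The big finitistic dimension of `R` (left modules). -/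
noncomputable def bigFinitisticDim (R : Type u) [Ring R] : WithBot ℕ∞ :=
  ⨆ (X : ModuleCat.{u} R) (_ : projectiveDimension X < ⊤), projectiveDimension X

/-- The global dimension of `R` (left modules). -/
noncomputable def globalDim (R : Type u) [Ring R] : WithBot ℕ∞ :=
  ⨆ X : ModuleCat.{u} R, projectiveDimension X

/-! ### Tensor powers and perfect bimodules -/

/-- Bundled `Γ`-bimodules. -/
structure BundledBimodule (Γ : Type u) [Ring Γ] where
  carrier : Type u
  [addCommGroup : AddCommGroup carrier]
  [leftModule : Module Γ carrier]
  [rightModule : Module Γᵐᵒᵖ carrier]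
  [smulCommClass : SMulCommClass Γ Γᵐᵒᵖ carrier]

attribute [instance] BundledBimodule.addCommGroup BundledBimodule.leftModule
  BundledBimodule.rightModule BundledBimodule.smulCommClass

section Bimodules

variable (Γ M : Type u) [Ring Γ] [AddCommGroup M] [Module Γ M] [Module Γᵐᵒᵖ M]
  [SMulCommClass Γ Γᵐᵒᵖ M]

/-- The tensor powers of a bimodule, with `M^{⊗0} = Γ`, `M^{⊗1} = M` and
`M^{⊗(n+1)} = M^{⊗n} ⊗_Γ M` for `n ≥ 1`. -/
def tensorPow : ℕ → BundledBimodule Γ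
  | 0 => ⟨Γ⟩
  | 1 => ⟨M⟩
  | n + 2 => ⟨RTensor Γ (tensorPow (n + 1)).carrier M⟩

/-- `M^{⊗i} = 0` for some `i > 1`. -/
def IsTensorNilpotent : Prop :=
  ∃ i : ℕ, 1 < i ∧ Subsingleton (tensorPow Γ M i).carrier

/-- `Tor_i(M^{⊗j}, M) = 0` for all `i, j ≥ 1`, and `M` has finite projective dimension as a right
module. -/
def IsRightPerfect : Prop :=
  (∀ i j : ℕ, 1 ≤ i → 1 ≤ j → Limits.IsZero (TorGroup Γ i (tensorPow Γ M j).carrier M)) ∧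
    projectiveDimension (ModuleCat.of Γᵐᵒᵖ M) < ⊤

/-- `Tor_i(M, M^{⊗j}) = 0` for all `i, j ≥ 1`, and `M` has finite projective dimension as a left
module. -/
def IsLeftPerfect : Prop :=
  (∀ i j : ℕ, 1 ≤ i → 1 ≤ j → Limits.IsZero (TorGroup Γ i M (tensorPow Γ M j).carrier)) ∧
    projectiveDimension (ModuleCat.of Γ M) < ⊤

/-- A bimodule is perfect if it is left and right perfect. -/
def IsPerfectBimodule : Prop := IsLeftPerfect Γ M ∧ IsRightPerfect Γ M

/-! ### Multiplicative bimodules and split extensions -/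

/-- An associative bimodule homomorphism `θ : M ⊗_Γ M → M`. -/
structure BimoduleMul where
  /-- `θ` as a homomorphism of right modules -/
  hom : RTensor Γ M M →ₗ[Γᵐᵒᵖ] M
  map_left_smul : ∀ (γ : Γ) (t : RTensor Γ M M), hom (γ • t) = γ • hom t
  assoc : ∀ x y z : M, hom (RTensor.tmul Γ (hom (RTensor.tmul Γ x y)) z) =
    hom (RTensor.tmul Γ x (hom (RTensor.tmul Γ y z)))

variable {Γ M}

/-- The underlying additive group `Γ ⊕ M` of the split extension `Γ ⋉_θ M`. -/
@[ext] structure SplitExtension (θ : BimoduleMul Γ M) : Type u where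
  fst : Γ
  snd : M

namespace BimoduleMul

variable (θ : BimoduleMul Γ M)

/-- `θ^r : M^{⊗(r+1)} → M`, with `θ^0 = id` and `θ^{r+1} = θ ∘ (θ^r ⊗ 1)`. -/
noncomputable def iter : (r : ℕ) → (tensorPow Γ M (r + 1)).carrier →ₗ[Γᵐᵒᵖ] M
  | 0 => (LinearMap.id : M →ₗ[Γᵐᵒᵖ] M)
  | r + 1 => θ.hom ∘ₗ
      (RTensor.rTensorMap Γ (iter r) :
        RTensor Γ (tensorPow Γ M (r + 1)).carrier M →ₗ[Γᵐᵒᵖ] RTensor Γ M M)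

/-- `θ^N = 0` for some positive integer `N`. -/
def IsNilpotent : Prop := ∃ N : ℕ, 0 < N ∧ θ.iter N = 0

end BimoduleMul

namespace SplitExtension

variable {θ : BimoduleMul Γ M}

/-- `Γ ⋉_θ M` is `Γ ⊕ M` as a set. -/
def equivProd (θ : BimoduleMul Γ M) : SplitExtension θ ≃ Γ × M where
  toFun a := (a.fst, a.snd)
  invFun p := ⟨p.1, p.2⟩
  left_inv _ := rfl
  right_inv _ := rfl

instance : AddCommGroup (SplitExtension θ) := (equivProd θ).addCommGroup

@[simp] theorem fst_zero : (0 : SplitExtension θ).fst = 0 := rfl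
@[simp] theorem snd_zero : (0 : SplitExtension θ).snd = 0 := rfl
@[simp] theorem fst_add (a b : SplitExtension θ) : (a + b).fst = a.fst + b.fst := rfl
@[simp] theorem snd_add (a b : SplitExtension θ) : (a + b).snd = a.snd + b.snd := rfl

instance : One (SplitExtension θ) := ⟨⟨1, 0⟩⟩

instance : Mul (SplitExtension θ) :=
  ⟨fun a b => ⟨a.fst * b.fst,
    a.fst • b.snd + op b.fst • a.snd + θ.hom (RTensor.tmul Γ a.snd b.snd)⟩⟩

@[simp] theorem fst_one : (1 : SplitExtension θ).fst = 1 := rfl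
@[simp] theorem snd_one : (1 : SplitExtension θ).snd = 0 := rfl
@[simp] theorem fst_mul (a b : SplitExtension θ) : (a * b).fst = a.fst * b.fst := rfl
@[simp] theorem snd_mul (a b : SplitExtension θ) : (a * b).snd =
    a.fst • b.snd + op b.fst • a.snd + θ.hom (RTensor.tmul Γ a.snd b.snd) := rfl

/-- The ring structure on `Γ ⋉_θ M`, with multiplication
`(γ₁, m₁) (γ₂, m₂) = (γ₁ γ₂, γ₁ m₂ + m₁ γ₂ + θ (m₁ ⊗ m₂))`. -/
instance : Ring (SplitExtension θ) where
  __ := (inferInstance : AddCommGroup (SplitExtension θ))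
  left_distrib a b c := by
    ext
    · simp [mul_add]
    · simp only [snd_mul, fst_add, snd_add, MulOpposite.op_add, add_smul, smul_add,
        RTensor.tmul_add, map_add]
      abel
  right_distrib a b c := by
    ext
    · simp [add_mul]
    · simp only [snd_mul, fst_add, snd_add, add_smul, smul_add, RTensor.add_tmul, map_add]
      abel
  zero_mul a := by ext <;> simp
  mul_zero a := by ext <;> simp
  one_mul a := by ext <;> simp
  mul_one a := by ext <;> simp
  mul_assoc a b c := by
    ext
    · simp [mul_assoc]
    · simp only [snd_mul, fst_mul, MulOpposite.op_mul, mul_smul, smul_add, RTensor.tmul_add,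
        RTensor.add_tmul, map_add, θ.assoc, RTensor.smul_tmul]
      have h1 : θ.hom (RTensor.tmul Γ (a.fst • b.snd) c.snd) =
          a.fst • θ.hom (RTensor.tmul Γ b.snd c.snd) := by
        rw [← θ.map_left_smul, RTensor.left_smul_tmul]
      have h2 : θ.hom (RTensor.tmul Γ a.snd (op c.fst • b.snd)) =
          op c.fst • θ.hom (RTensor.tmul Γ a.snd b.snd) := by
        rw [← map_smul, RTensor.right_smul_tmul]
      have h3 : op c.fst • a.fst • b.snd = a.fst • op c.fst • b.snd :=
        (smul_comm a.fst (op c.fst) b.snd).symm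
      rw [h1, h2, h3]
      abel
  neg_add_cancel a := neg_add_cancel a
  zsmul := fun n a => n • a
  zsmul_zero' := fun a => zero_zsmul a
  zsmul_succ' := fun n a => SubNegMonoid.zsmul_succ' n a
  zsmul_neg' := fun n a => SubNegMonoid.zsmul_neg' n a

variable (θ)

/-- The ideal `0 ⊕ M` of `Γ ⋉_θ M` as a left submodule. -/
def leftKer : Submodule (SplitExtension θ) (SplitExtension θ) where
  carrier := {a | a.fst = 0}
  add_mem' {a b} ha hb := by
    simp only [Set.mem_ofPred_eq] at ha hb ⊢
    simp [ha, hb]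
  zero_mem' := rfl
  smul_mem' c a ha := by
    simp only [Set.mem_ofPred_eq] at ha ⊢
    simp [ha]

/-- The ideal `0 ⊕ M` of `Γ ⋉_θ M` as a right submodule. -/
def rightKer : Submodule (SplitExtension θ)ᵐᵒᵖ (SplitExtension θ) where
  carrier := {a | a.fst = 0}
  add_mem' {a b} ha hb := by
    simp only [Set.mem_ofPred_eq] at ha hb ⊢
    simp [ha, hb]
  zero_mem' := rfl
  smul_mem' c a ha := by
    simp only [Set.mem_ofPred_eq] at ha ⊢
    simp [ha]

/-- The projective dimension of `0 ⊕ M` as a left `Γ ⋉_θ M`-module. -/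
noncomputable def leftKerPD : WithBot ℕ∞ :=
  projectiveDimension (ModuleCat.of (SplitExtension θ) (leftKer θ))

/-- The projective dimension of `0 ⊕ M` as a right `Γ ⋉_θ M`-module. -/
noncomputable def rightKerPD : WithBot ℕ∞ :=
  projectiveDimension (ModuleCat.of (SplitExtension θ)ᵐᵒᵖ (rightKer θ))

end SplitExtension

namespace BimoduleMul

variable (θ : BimoduleMul Γ M)

/-- `(M, θ)` is nilpotent and `0 ⊕ M` has finite projective dimension over `Γ ⋉_θ M` on both
sides. -/
def IsTwoSidedRemovable : Prop :=
  θ.IsNilpotent ∧ SplitExtension.rightKerPD θ < ⊤ ∧ SplitExtension.leftKerPD θ < ⊤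

/-- `(M, θ)` is nilpotent, `0 ⊕ M` has finite projective dimension on the right but not on the
left, and `θ = 0`. -/
def IsOnlyLeftRemovable : Prop :=
  θ.IsNilpotent ∧ SplitExtension.rightKerPD θ < ⊤ ∧ ¬ SplitExtension.leftKerPD θ < ⊤ ∧
    θ.hom = 0

/-- `(M, θ)` is (left) removable if it is two-sided or only left removable. -/
def IsRemovable : Prop := θ.IsTwoSidedRemovable ∨ θ.IsOnlyLeftRemovable

end BimoduleMul

end Bimodules

/-! Write `E` for `SplitExtension θ`. Since `θ^r` is defined on `M^{⊗(r+1)}`, tensor nilpotency of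
`M` forces `θ` to be nilpotent, so `0 ⊕ M` is a nilpotent ideal of `E`.

Finite projective dimension of `0 ⊕ M`. For a right `E`-module `X` the action map `X ⊗_Γ E → X` is
onto. Because `E = Γ ⊕ M` over `Γ`, its kernel is `X ⊗_Γ M` as a `Γ`-module. Starting from `X = 0 ⊕
M` and passing to kernels repeatedly gives `E`-modules that restrict to `M`, `M^{⊗2}`, `M^{⊗3}`,
..., and eventually vanish. The middle terms, induced from `M^{⊗j}`, have finite projective
dimension over `E`, because perfectness makes `M^{⊗j}` of finite projective dimension over `Γ` and
kills its higher Tor with `E`. This is `exists_pdlt_right`, with mirror image `exists_pdlt_left`.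

Comparison of dimensions. Let `A` be an `S`-`R`-bimodule, projective over `S` and of projective
dimension at most `d` as a right `R`-module, such that `A ⊗_R -` reflects projectivity of modules
with vanishing `Tor_1`. A `d`-th syzygy over `R` has no higher Tor with `A`, so tensoring keeps its
projective resolutions exact, and its projective dimension is at most that of its tensor product
with `A`. A bound `f` over `S` therefore yields the bound `f + d` over `R`
(`ReflectsProjective.pdlt_of_forall`). The principle is used twice. For `A = E`, from `Γ` to `E`, a
module is recovered as `Γ ⊗_E E ⊗_Γ X`. For `A = Γ`, from `E` to `Γ`, a Nakayama argument lifts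
projectivity from `X / (0 ⊕ M)X` to `X` (`SplitExtension.reflectsProjective_base`). The two finite
right projective dimensions come from those of `M` over `Γ` and of `0 ⊕ M` over `E`.

Only right perfectness enters the comparison. The choice between the two alternatives matters for
removability alone.

Tor is handled through injectivity statements (`TorVanish`), for which balance and dimension
shifting are short diagram chases; `TorVanish.of_isZero_torGroup` connects them with the derived
functor. -/

/-! ### Projective dimension of modules -/

section ProjectiveDimension

/-- The projective dimension of `X` is less than `n`. -/
abbrev PDLT (R X : Type u) [Ring R] [AddCommGroup X] [Module R X] (n : ℕ) : Prop :=
  HasProjectiveDimensionLT (ModuleCat.of R X) n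

namespace PDLT

variable {R : Type u} [Ring R] {X Y Z : Type u} [AddCommGroup X] [Module R X]
  [AddCommGroup Y] [Module R Y] [AddCommGroup Z] [Module R Z]

theorem _root_.shortExact_of_linearMap {f : X →ₗ[R] Y} {g : Y →ₗ[R] Z}
    (hf : Function.Injective f) (hg : Function.Surjective g) (h : Function.Exact f g) :
    (ShortComplex.mk (ModuleCat.ofHom f) (ModuleCat.ofHom g)
      (by ext x; exact h.apply_apply_eq_zero x)).ShortExact where
  exact := (ShortComplex.ShortExact.moduleCat_exact_iff_function_exact _).2 h
  mono_f := (ModuleCat.mono_iff_injective _).2 hf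
  epi_g := (ModuleCat.epi_iff_surjective _).2 hg

theorem mono {m n : ℕ} (hmn : m ≤ n) (h : PDLT R X m) : PDLT R X n :=
  hasProjectiveDimensionLT_of_ge _ m n hmn

theorem third {f : X →ₗ[R] Y} {g : Y →ₗ[R] Z} (hf : Function.Injective f)
    (hg : Function.Surjective g) (h : Function.Exact f g) {n : ℕ} (hX : PDLT R X n)
    (hY : PDLT R Y (n + 1)) : PDLT R Z (n + 1) :=
  (shortExact_of_linearMap hf hg h).hasProjectiveDimensionLT_X₃ n hX hY

theorem first {f : X →ₗ[R] Y} {g : Y →ₗ[R] Z} (hf : Function.Injective f)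
    (hg : Function.Surjective g) (h : Function.Exact f g) {n : ℕ} (hY : PDLT R Y n)
    (hZ : PDLT R Z (n + 1)) : PDLT R X n :=
  (shortExact_of_linearMap hf hg h).hasProjectiveDimensionLT_X₁ n hY hZ

theorem second {f : X →ₗ[R] Y} {g : Y →ₗ[R] Z} (hf : Function.Injective f)
    (hg : Function.Surjective g) (h : Function.Exact f g) {n : ℕ} (hX : PDLT R X n)
    (hZ : PDLT R Z n) : PDLT R Y n :=
  (shortExact_of_linearMap hf hg h).hasProjectiveDimensionLT_X₂ n hX hZ

theorem of_retract (i : X →ₗ[R] Y) (r : Y →ₗ[R] X) (h : ∀ x, r (i x) = x) {n : ℕ}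
    (hY : PDLT R Y n) : PDLT R X n :=
  Retract.hasProjectiveDimensionLT (Y := ModuleCat.of R Y)
    ⟨ModuleCat.ofHom i, ModuleCat.ofHom r, by ext x; exact h x⟩ n

theorem of_equiv (e : X ≃ₗ[R] Y) {n : ℕ} (hX : PDLT R X n) : PDLT R Y n :=
  of_retract e.symm.toLinearMap e.toLinearMap e.apply_symm_apply hX

theorem one_iff : PDLT R X 1 ↔ Module.Projective R X := by
  rw [PDLT, ← projective_iff_hasProjectiveDimensionLT_one, ← IsProjective.iff_projective]

theorem of_projective [h : Module.Projective R X] {n : ℕ} : PDLT R X (n + 1) :=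
  mono (Nat.le_add_left 1 n) (one_iff.2 h)

theorem of_subsingleton [Subsingleton X] {n : ℕ} : PDLT R X n :=
  mono (Nat.zero_le n) (ModuleCat.isZero_of_subsingleton (ModuleCat.of R X)).hasProjectiveDimensionLT_zero

theorem subsingleton (h : PDLT R X 0) : Subsingleton X :=
  ModuleCat.subsingleton_of_isZero (isZero_of_hasProjectiveDimensionLT_zero (ModuleCat.of R X))

theorem lt_top_iff : projectiveDimension (ModuleCat.of R X) < ⊤ ↔ ∃ n, PDLT R X (n + 1) := by
  rw [lt_top_iff_ne_top, projectiveDimension_ne_top_iff]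

end PDLT

/-! ### Free covers and first syzygies -/

section Syzygy

variable (R X : Type u) [Ring R] [AddCommGroup X] [Module R X]

/-- The free module `R^(X)`. -/
def FreeMod (R X : Type u) [Ring R] : Type u := X →₀ R

noncomputable instance : AddCommGroup (FreeMod R X) := inferInstanceAs (AddCommGroup (X →₀ R))
noncomputable instance : Module R (FreeMod R X) := inferInstanceAs (Module R (X →₀ R))
instance : Module.Projective R (FreeMod R X) :=
  inferInstanceAs (Module.Projective R (X →₀ R))

/-- The free cover `R^(X) → X`. -/
noncomputable def freeCover : FreeMod R X →ₗ[R] X := Finsupp.linearCombination R (id : X → X)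

/-- The kernel of the free cover `R^(X) → X`. -/
def Syz : Type u := LinearMap.ker (freeCover R X)

noncomputable instance : AddCommGroup (Syz R X) :=
  inferInstanceAs (AddCommGroup (LinearMap.ker (freeCover R X)))
noncomputable instance : Module R (Syz R X) :=
  inferInstanceAs (Module R (LinearMap.ker (freeCover R X)))

/-- The inclusion of the first syzygy into the free cover. -/
noncomputable def Syz.incl : Syz R X →ₗ[R] FreeMod R X := (LinearMap.ker (freeCover R X)).subtype

variable {R X}

theorem freeCover_surjective : Function.Surjective (freeCover R X) :=
  Finsupp.linearCombination_id_surjective R X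

theorem Syz.incl_injective : Function.Injective (Syz.incl R X) :=
  Submodule.injective_subtype _

theorem Syz.exact : Function.Exact (Syz.incl R X) (freeCover R X) :=
  LinearMap.exact_subtype_ker_map _

variable {K P : Type u} [AddCommGroup K] [Module R K] [AddCommGroup P] [Module R P]

theorem PDLT.syzygy {f : K →ₗ[R] P} {g : P →ₗ[R] X} (hf : Function.Injective f)
    (hg : Function.Surjective g) (h : Function.Exact f g) [Module.Projective R P] {n : ℕ}
    (hX : PDLT R X (n + 2)) : PDLT R K (n + 1) :=
  first hf hg h of_projective hX

/-- The copower of the free cover of `X` is again a projective cover map whose kernel is the copower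
of the syzygy. Arbitrary `ι` is needed because tensoring with a projective module gives a retract of
a possibly infinite copower. -/
theorem PDLT.finsupp (ι : Type u) {n : ℕ} (hX : PDLT R X n) : PDLT R (ι →₀ X) n := by
  induction n generalizing X with
  | zero =>
    have := hX.subsingleton
    exact of_subsingleton
  | succ n ih =>
    rcases n with _ | n
    · classical
      have := one_iff.1 hX
      have : Module.Projective R (ι →₀ X) := Module.Projective.of_equiv
        (finsuppLequivDFinsupp R (ι := ι) (M := X)).symm
      exact of_projective
    · classical
      refine third (X := ι →₀ Syz R X) (Y := ι →₀ FreeMod R X)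
        (f := Finsupp.mapRange.linearMap (Syz.incl R X))
        (g := Finsupp.mapRange.linearMap (freeCover R X)) ?_ ?_ ?_
        (ih (PDLT.syzygy Syz.incl_injective freeCover_surjective Syz.exact hX)) ?_
      · exact Finsupp.mapRange_injective _ (map_zero _) Syz.incl_injective
      · exact Finsupp.mapRange_surjective _ (map_zero _) freeCover_surjective
      · rw [LinearMap.exact_iff, Finsupp.ker_mapRange, Finsupp.range_mapRange_linearMap,
          Syz.exact.linearMap_ker_eq]
        exact LinearMap.ker_eq_bot.2 Syz.incl_injective
      · have : Module.Projective R (ι →₀ FreeMod R X) := Module.Projective.of_equiv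
          (finsuppLequivDFinsupp R (ι := ι) (M := FreeMod R X)).symm
        exact of_projective

end Syzygy

end ProjectiveDimension

/-! ### Tensor products over a noncommutative ring: right exactness and flatness -/

namespace RTensor

variable (Γ : Type u) [Ring Γ]

section

variable {X Y X' Y' : Type u}
  [AddCommGroup X] [Module Γᵐᵒᵖ X] [AddCommGroup Y] [Module Γ Y]
  [AddCommGroup X'] [Module Γᵐᵒᵖ X'] [AddCommGroup Y'] [Module Γ Y']

variable {Γ} in
@[elab_as_elim]
theorem induction_on {p : RTensor Γ X Y → Prop} (t : RTensor Γ X Y) (zero : p 0)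
    (tmul : ∀ x y, p (tmul Γ x y)) (add : ∀ s t, p s → p t → p (s + t)) : p t := by
  obtain ⟨s, rfl⟩ := QuotientAddGroup.mk_surjective t
  induction s with
  | zero => exact zero
  | tmul x y => exact tmul x y
  | add s t hs ht => exact add _ _ hs ht

/-- The additive map on `X ⊗_Γ Y` induced by a balanced biadditive map. -/
def lift {G : Type*} [AddCommGroup G] (φ : X →+ Y →+ G)
    (h : ∀ x (γ : Γ) y, φ (op γ • x) y = φ x (γ • y)) : RTensor Γ X Y →+ G :=
  QuotientAddGroup.lift (balancedRel Γ X Y)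
    (TensorProduct.liftAddHom φ fun r x y => by simp) (by
      rw [balancedRel, AddSubgroup.closure_le]
      rintro _ ⟨x, γ, y, rfl⟩
      simp [h])

@[simp] theorem lift_tmul {G : Type*} [AddCommGroup G] (φ : X →+ Y →+ G)
    (h : ∀ x (γ : Γ) y, φ (op γ • x) y = φ x (γ • y)) (x : X) (y : Y) :
    lift Γ φ h (tmul Γ x y) = φ x y := rfl

/-- The map `y ↦ x ⊗ y`. -/
def tmulHom (x : X) : Y →+ RTensor Γ X Y := AddMonoidHom.mk' (tmul Γ x) (tmul_add Γ x)

/-- The map `x ↦ x ⊗ y`. -/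
def tmulHomFlip (y : Y) : X →+ RTensor Γ X Y :=
  AddMonoidHom.mk' (fun x => tmul Γ x y) (fun x x' => add_tmul Γ x x' y)

@[simp] theorem tmulHom_apply (x : X) (y : Y) : tmulHom Γ x y = tmul Γ x y := rfl
@[simp] theorem tmulHomFlip_apply (x : X) (y : Y) : tmulHomFlip Γ y x = tmul Γ x y := rfl

theorem map_map {X'' Y'' : Type u} [AddCommGroup X''] [Module Γᵐᵒᵖ X''] [AddCommGroup Y'']
    [Module Γ Y''] (f' : X' →ₗ[Γᵐᵒᵖ] X'') (g' : Y' →ₗ[Γ] Y'') (f : X →ₗ[Γᵐᵒᵖ] X')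
    (g : Y →ₗ[Γ] Y') (t : RTensor Γ X Y) :
    map Γ f' g' (map Γ f g t) = map Γ (f' ∘ₗ f) (g' ∘ₗ g) t :=
  (DFunLike.congr_fun (map_comp Γ f' g' f g) t).symm

theorem map_surjective {f : X →ₗ[Γᵐᵒᵖ] X'} {g : Y →ₗ[Γ] Y'} (hf : Function.Surjective f)
    (hg : Function.Surjective g) : Function.Surjective (map Γ f g) := fun t => by
  induction t using induction_on with
  | zero => exact ⟨0, map_zero _⟩
  | tmul x y =>
    obtain ⟨x, rfl⟩ := hf x
    obtain ⟨y, rfl⟩ := hg y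
    exact ⟨tmul Γ x y, rfl⟩
  | add s t hs ht =>
    obtain ⟨s, rfl⟩ := hs
    obtain ⟨t, rfl⟩ := ht
    exact ⟨s + t, map_add _ _ _⟩

variable {K L : Type u} [AddCommGroup K] [Module Γᵐᵒᵖ K] [AddCommGroup L] [Module Γ L]

/-- Right exactness in both variables at once, reduced to the known kernel of a tensor product of
surjections over `ℤ`. -/
theorem exists_of_map_eq_zero {i : K →ₗ[Γᵐᵒᵖ] X} {f : X →ₗ[Γᵐᵒᵖ] X'} {j : L →ₗ[Γ] Y}
    {g : Y →ₗ[Γ] Y'} (hf : Function.Surjective f) (hg : Function.Surjective g)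
    (hif : Function.Exact i f) (hjg : Function.Exact j g) {t : RTensor Γ X Y}
    (ht : map Γ f g t = 0) :
    ∃ (a : RTensor Γ X L) (b : RTensor Γ K Y), t = map Γ .id j a + map Γ i .id b := by
  obtain ⟨s, rfl⟩ := QuotientAddGroup.mk_surjective t
  let F : TensorProduct ℤ X Y →ₗ[ℤ] TensorProduct ℤ X' Y' :=
    TensorProduct.map f.toAddMonoidHom.toIntLinearMap g.toAddMonoidHom.toIntLinearMap
  have h1 : F s ∈ balancedRel Γ X' Y' := (QuotientAddGroup.eq_zero_iff _).1 ht
  -- Surjectivity of `f` and `g` lifts every balancing relation, so a representative `s` can be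
  -- corrected by such a lift `r` to lie in the kernel over `ℤ`.
  have h2 : balancedRel Γ X' Y' ≤ (balancedRel Γ X Y).map F.toAddMonoidHom := by
    rw [balancedRel, AddSubgroup.closure_le]
    rintro _ ⟨x, γ, y, rfl⟩
    obtain ⟨x, rfl⟩ := hf x
    obtain ⟨y, rfl⟩ := hg y
    refine ⟨_, AddSubgroup.subset_closure ⟨x, γ, y, rfl⟩, ?_⟩
    rw [map_sub]
    exact congrArg₂ (· - ·) (congrArg₂ (TensorProduct.tmul ℤ) (map_smul f (op γ) x) rfl)
      (congrArg₂ (TensorProduct.tmul ℤ) rfl (map_smul g γ y))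
  obtain ⟨r, hr, hrs⟩ := h2 h1
  have h3 : F (s - r) = 0 := by
    rw [map_sub, sub_eq_zero]
    exact hrs.symm
  obtain ⟨_, ⟨a, rfl⟩, _, ⟨b, rfl⟩, hab⟩ := Submodule.mem_sup.1 <|
    (TensorProduct.map_ker (f := i.toAddMonoidHom.toIntLinearMap)
      (g := f.toAddMonoidHom.toIntLinearMap) hif hf (f' := j.toAddMonoidHom.toIntLinearMap)
      (g' := g.toAddMonoidHom.toIntLinearMap) hjg hg).le h3
  refine ⟨mk Γ a, mk Γ b, ?_⟩
  have h4 : mk Γ s = mk Γ (s - r) := by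
    have h5 : mk Γ r = 0 := (QuotientAddGroup.eq_zero_iff r).2 hr
    rw [map_sub, h5, sub_zero]
  exact (h4.trans (congrArg _ hab.symm)).trans (map_add _ _ _)

theorem exact_map_left (B : Type u) [AddCommGroup B] [Module Γ B] {i : K →ₗ[Γᵐᵒᵖ] X}
    {f : X →ₗ[Γᵐᵒᵖ] X'} (hf : Function.Surjective f) (hif : Function.Exact i f) :
    Function.Exact (map Γ i (.id : B →ₗ[Γ] B)) (map Γ f (.id : B →ₗ[Γ] B)) := by
  refine fun t => ⟨fun ht => ?_, ?_⟩
  -- The second factor is an identity, whose kernel is the image of the zero module; its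
  -- contribution `a` disappears.
  · obtain ⟨a, b, rfl⟩ := exists_of_map_eq_zero Γ hf Function.surjective_id hif
      (j := (0 : PUnit.{u + 1} →ₗ[Γ] B)) (fun y => ⟨fun h => ⟨0, h.symm⟩, fun ⟨_, h⟩ => h.symm⟩) ht
    exact ⟨b, by simp [map_zero_right]⟩
  · rintro ⟨b, rfl⟩
    rw [map_map, hif.linearMap_comp_eq_zero, map_zero_left]
    rfl

theorem exact_map_right (A : Type u) [AddCommGroup A] [Module Γᵐᵒᵖ A] {j : L →ₗ[Γ] Y}
    {g : Y →ₗ[Γ] Y'} (hg : Function.Surjective g) (hjg : Function.Exact j g) :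
    Function.Exact (map Γ (.id : A →ₗ[Γᵐᵒᵖ] A) j) (map Γ (.id : A →ₗ[Γᵐᵒᵖ] A) g) := by
  refine fun t => ⟨fun ht => ?_, ?_⟩
  · obtain ⟨a, b, rfl⟩ := exists_of_map_eq_zero Γ Function.surjective_id hg
      (i := (0 : PUnit.{u + 1} →ₗ[Γᵐᵒᵖ] A)) (fun y => ⟨fun h => ⟨0, h.symm⟩, fun ⟨_, h⟩ => h.symm⟩)
      hjg ht
    exact ⟨a, by simp [map_zero_left]⟩
  · rintro ⟨b, rfl⟩
    rw [map_map, hjg.linearMap_comp_eq_zero, map_zero_right]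
    rfl

/-! ### Coordinates on tensor products with projective modules -/

section Coordinates

variable {ι : Type*}

/-- The map `X ⊗_Γ Y → Y^(ι)` given by coordinates of the right module `X`. -/
noncomputable def coordLeft (s : X →ₗ[Γᵐᵒᵖ] (ι →₀ Γᵐᵒᵖ)) : RTensor Γ X Y →+ (ι →₀ Y) :=
  lift Γ (AddMonoidHom.mk' (fun x => AddMonoidHom.mk'
      (fun y => (s x).mapRange (fun a => a.unop • y) (by simp))
      (fun y y' => by ext; simp))
    (fun x x' => by ext; simp [add_smul]))
    (fun x γ y => by ext; simp [mul_smul])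

@[simp] theorem coordLeft_tmul_apply (s : X →ₗ[Γᵐᵒᵖ] (ι →₀ Γᵐᵒᵖ)) (x : X) (y : Y) (i : ι) :
    coordLeft Γ s (tmul Γ x y) i = (s x i).unop • y := rfl

/-- The map `Y^(ι) → X ⊗_Γ Y` given by a family in the right module `X`. -/
noncomputable def ofCoordLeft (b : ι → X) : (ι →₀ Y) →+ RTensor Γ X Y :=
  Finsupp.liftAddHom fun i => tmulHom Γ (b i)

@[simp] theorem ofCoordLeft_single (b : ι → X) (i : ι) (y : Y) :
    ofCoordLeft Γ b (Finsupp.single i y) = tmul Γ (b i) y := by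
  simp [ofCoordLeft]

theorem ofCoordLeft_coordLeft (s : X →ₗ[Γᵐᵒᵖ] (ι →₀ Γᵐᵒᵖ)) (b : ι → X)
    (h : ∀ x, Finsupp.linearCombination Γᵐᵒᵖ b (s x) = x) (t : RTensor Γ X Y) :
    ofCoordLeft Γ b (coordLeft Γ s t) = t := by
  induction t using induction_on with
  | zero => simp
  | add s t hs ht => rw [map_add, map_add, hs, ht]
  | tmul x y =>
    have key : ∀ c : ι →₀ Γᵐᵒᵖ, ofCoordLeft Γ b
        (c.mapRange (fun a => a.unop • y) (by simp)) =
          tmul Γ (Finsupp.linearCombination Γᵐᵒᵖ b c) y := fun c => by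
      induction c using Finsupp.induction_linear with
      | zero => simp
      | add c d hc hd =>
        rw [Finsupp.mapRange_add (fun a b => by simp [add_smul]), map_add, hc, hd, map_add,
          add_tmul]
      | single i a =>
        rw [Finsupp.mapRange_single, ofCoordLeft_single, Finsupp.linearCombination_single,
          ← smul_tmul, op_unop]
    exact (key (s x)).trans (by rw [h])

/-- The map `X ⊗_Γ Y → X^(ι)` given by coordinates of the left module `Y`. -/
noncomputable def coordRight (s : Y →ₗ[Γ] (ι →₀ Γ)) : RTensor Γ X Y →+ (ι →₀ X) :=
  lift Γ (AddMonoidHom.mk' (fun x => AddMonoidHom.mk'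
      (fun y => (s y).mapRange (fun a => op a • x) (by simp))
      (fun y y' => by ext; simp [add_smul]))
    (fun x x' => by ext; simp))
    (fun x γ y => by ext; simp [mul_smul])

@[simp] theorem coordRight_tmul_apply (s : Y →ₗ[Γ] (ι →₀ Γ)) (x : X) (y : Y) (i : ι) :
    coordRight Γ s (tmul Γ x y) i = op (s y i) • x := rfl

/-- The map `X^(ι) → X ⊗_Γ Y` given by a family in the left module `Y`. -/
noncomputable def ofCoordRight (b : ι → Y) : (ι →₀ X) →+ RTensor Γ X Y :=
  Finsupp.liftAddHom fun i => tmulHomFlip Γ (b i)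

@[simp] theorem ofCoordRight_single (b : ι → Y) (i : ι) (x : X) :
    ofCoordRight Γ b (Finsupp.single i x) = tmul Γ x (b i) := by
  simp [ofCoordRight]

theorem ofCoordRight_coordRight (s : Y →ₗ[Γ] (ι →₀ Γ)) (b : ι → Y)
    (h : ∀ y, Finsupp.linearCombination Γ b (s y) = y) (t : RTensor Γ X Y) :
    ofCoordRight Γ b (coordRight Γ s t) = t := by
  induction t using induction_on with
  | zero => simp
  | add s t hs ht => rw [map_add, map_add, hs, ht]
  | tmul x y =>
    have key : ∀ c : ι →₀ Γ, ofCoordRight Γ b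
        (c.mapRange (fun a => op a • x) (by simp)) =
          tmul Γ x (Finsupp.linearCombination Γ b c) := fun c => by
      induction c using Finsupp.induction_linear with
      | zero => simp
      | add c d hc hd =>
        rw [Finsupp.mapRange_add (fun a b => by simp [add_smul]), map_add, hc, hd, map_add,
          tmul_add]
      | single i a =>
        rw [Finsupp.mapRange_single, ofCoordRight_single, Finsupp.linearCombination_single,
          smul_tmul]
    exact (key (s y)).trans (by rw [h])

end Coordinates

/-- Flatness of projectives: a section of the free cover of `X` embeds `X ⊗_Γ Y` into a copower of
`Y`, naturally in `Y`, and copowers preserve injectivity. -/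
theorem map_injective_of_projective_left [Module.Projective Γᵐᵒᵖ X] {g : Y →ₗ[Γ] Y'}
    (hg : Function.Injective g) : Function.Injective (map Γ (.id : X →ₗ[Γᵐᵒᵖ] X) g) := by
  obtain ⟨s, hs⟩ := Module.projective_def'.1 (inferInstance : Module.Projective Γᵐᵒᵖ X)
  have h : ∀ t : RTensor Γ X Y, coordLeft Γ s (map Γ .id g t) =
      (coordLeft Γ s t).mapRange g (map_zero g) := fun t => by
    induction t using induction_on with
    | zero => simp
    | tmul x y => ext; simp
    | add s t hs ht => simp only [map_add, hs, ht, Finsupp.mapRange_add (map_add g)]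
  refine (injective_iff_map_eq_zero _).2 fun t ht => ?_
  have h' := h t
  rw [ht, map_zero] at h'
  rw [← ofCoordLeft_coordLeft Γ s id (LinearMap.congr_fun hs) t,
    Finsupp.mapRange_injective _ (map_zero g) hg (h'.symm.trans Finsupp.mapRange_zero.symm),
    map_zero]

theorem map_injective_of_projective_right [Module.Projective Γ Y] {f : X →ₗ[Γᵐᵒᵖ] X'}
    (hf : Function.Injective f) : Function.Injective (map Γ f (.id : Y →ₗ[Γ] Y)) := by
  obtain ⟨s, hs⟩ := Module.projective_def'.1 (inferInstance : Module.Projective Γ Y)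
  have h : ∀ t : RTensor Γ X Y, coordRight Γ s (map Γ f .id t) =
      (coordRight Γ s t).mapRange f (map_zero f) := fun t => by
    induction t using induction_on with
    | zero => simp
    | tmul x y => ext; simp
    | add s t hs ht => simp only [map_add, hs, ht, Finsupp.mapRange_add (map_add f)]
  refine (injective_iff_map_eq_zero _).2 fun t ht => ?_
  have h' := h t
  rw [ht, map_zero] at h'
  rw [← ofCoordRight_coordRight Γ s id (LinearMap.congr_fun hs) t,
    Finsupp.mapRange_injective _ (map_zero f) hf (h'.symm.trans Finsupp.mapRange_zero.symm),
    map_zero]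

end

end RTensor

/-! ### Tensor products with an additional action -/

/-- `A ⊗_Γ Y` as a left `S`-module, for an `S`-`Γ`-bimodule `A`. -/
def TensL (Γ _S A Y : Type u) [Ring Γ] [AddCommGroup A] [Module Γᵐᵒᵖ A] [AddCommGroup Y]
    [Module Γ Y] : Type u :=
  RTensor Γ A Y

/-- `X ⊗_Γ B` as an `S`-module, for a `Γ`-module `B` with a commuting action of `S`. -/
def TensR (Γ _S X B : Type u) [Ring Γ] [AddCommGroup X] [Module Γᵐᵒᵖ X] [AddCommGroup B]
    [Module Γ B] : Type u :=
  RTensor Γ X B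

namespace TensL

variable (Γ S A : Type u) [Ring Γ] [Ring S] {X Y Z : Type u} [AddCommGroup A] [Module Γᵐᵒᵖ A]
  [Module S A] [SMulCommClass S Γᵐᵒᵖ A] [AddCommGroup X] [Module Γ X] [AddCommGroup Y]
  [Module Γ Y] [AddCommGroup Z] [Module Γ Z]

instance : AddCommGroup (TensL Γ S A Y) := inferInstanceAs (AddCommGroup (RTensor Γ A Y))

/-- The action of `S` on `A ⊗_Γ Y`. -/
def action : S →+* AddMonoid.End (TensL Γ S A Y) where
  toFun a := RTensor.map Γ (Module.toModuleEnd Γᵐᵒᵖ A a) LinearMap.id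
  map_one' := RTensor.hom_ext Γ fun x y => congrArg (RTensor.tmul Γ · y) (one_smul S x)
  map_mul' a b := RTensor.hom_ext Γ fun x y => congrArg (RTensor.tmul Γ · y) (mul_smul a b x)
  map_zero' := RTensor.hom_ext Γ fun x y =>
    (congrArg (RTensor.tmul Γ · y) (zero_smul S x)).trans (RTensor.zero_tmul Γ y)
  map_add' a b := RTensor.hom_ext Γ fun x y =>
    (congrArg (RTensor.tmul Γ · y) (add_smul a b x)).trans
      (RTensor.add_tmul Γ (a • x) (b • x) y)

instance : Module S (TensL Γ S A Y) := Module.compHom _ (action Γ S A (Y := Y))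

/-- The elementary tensor `a ⊗ y`. -/
abbrev tmul (a : A) (y : Y) : TensL Γ S A Y := RTensor.tmul Γ a y

variable {Γ S A}

theorem smul_tmul (s : S) (a : A) (y : Y) : s • tmul Γ S A a y = tmul Γ S A (s • a) y := rfl

/-- An additive map on `A ⊗_Γ Y` which is compatible with `S` on elementary tensors. -/
def mkLinear {G : Type u} [AddCommGroup G] [Module S G] (f : RTensor Γ A Y →+ G)
    (h : ∀ (s : S) a y, f (RTensor.tmul Γ (s • a) y) = s • f (RTensor.tmul Γ a y)) :
    TensL Γ S A Y →ₗ[S] G where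
  toFun := f
  map_add' := map_add f
  map_smul' s t := by
    have : f.comp (action Γ S A s) = (DistribSMul.toAddMonoidHom G s).comp f :=
      RTensor.hom_ext Γ fun a y => h s a y
    exact DFunLike.congr_fun this t

variable (S A) in
/-- The map `1 ⊗ g`. -/
def map (g : Y →ₗ[Γ] Z) : TensL Γ S A Y →ₗ[S] TensL Γ S A Z :=
  mkLinear (RTensor.map Γ .id g) fun _ _ _ => rfl

theorem map_surjective {g : Y →ₗ[Γ] Z} (hg : Function.Surjective g) :
    Function.Surjective (map S A g) :=
  RTensor.map_surjective Γ Function.surjective_id hg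

theorem map_exact {f : X →ₗ[Γ] Y} {g : Y →ₗ[Γ] Z} (hg : Function.Surjective g)
    (h : Function.Exact f g) : Function.Exact (map S A f) (map S A g) :=
  RTensor.exact_map_right Γ A hg h

variable (S A) in
/-- The map `A^(ι) → A ⊗_Γ Y` given by a family in `Y`. -/
noncomputable def ofCoord {ι : Type*} (b : ι → Y) : (ι →₀ A) →ₗ[S] TensL Γ S A Y where
  toFun := RTensor.ofCoordRight Γ b
  map_add' := map_add _
  map_smul' a c := by
    have : (RTensor.ofCoordRight Γ b).comp (DistribSMul.toAddMonoidHom (ι →₀ A) a) =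
        (RTensor.map Γ (Module.toModuleEnd Γᵐᵒᵖ A a) (.id : Y →ₗ[Γ] Y)).comp
          (RTensor.ofCoordRight Γ b) := Finsupp.addHom_ext fun i x => by
      simp
    exact DFunLike.congr_fun this c

/-- The coordinate maps are `S`-linear and exhibit `A ⊗_Γ Y` as a retract of a copower of `A`. -/
theorem pdlt_of_projective [Module.Projective Γ Y] {n : ℕ} (h : PDLT S A n) :
    PDLT S (TensL Γ S A Y) n := by
  obtain ⟨s, hs⟩ := Module.projective_def'.1 (inferInstance : Module.Projective Γ Y)
  refine PDLT.of_retract (mkLinear (RTensor.coordRight Γ s) fun a x y => ?_) (ofCoord S A id)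
    (RTensor.ofCoordRight_coordRight Γ s id (LinearMap.congr_fun hs)) (h.finsupp Y)
  ext i
  exact (smul_comm a (op (s y i)) x).symm

instance finite [Module.Finite S A] [Module.Finite Γ Y] : Module.Finite S (TensL Γ S A Y) := by
  obtain ⟨n, b, hb⟩ := Module.Finite.exists_fin (R := Γ) (M := Y)
  refine Module.Finite.of_surjective (ofCoord S A b) fun t => ?_
  change t ∈ LinearMap.range (ofCoord S A b)
  induction t using RTensor.induction_on with
  | zero => exact zero_mem _
  | add s t hs ht => exact add_mem hs ht
  | tmul a y =>
    have hy : y ∈ Submodule.span Γ (Set.range b) := hb ▸ Submodule.mem_top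
    induction hy using Submodule.span_induction generalizing a with
    | mem y hy =>
      obtain ⟨i, rfl⟩ := hy
      exact ⟨Finsupp.single i a, RTensor.ofCoordRight_single Γ b i a⟩
    | zero => rw [RTensor.tmul_zero]; exact zero_mem _
    | add x y _ _ hx hy => rw [RTensor.tmul_add]; exact add_mem (hx a) (hy a)
    | smul r x _ hx => rw [← RTensor.smul_tmul]; exact hx _

theorem projective [Module.Projective Γ Y] [h : Module.Projective S A] :
    Module.Projective S (TensL Γ S A Y) :=
  PDLT.one_iff.1 (pdlt_of_projective (PDLT.one_iff.2 h))

/-- `A ⊗_Γ Y` does not depend on the module `Y` up to isomorphism. -/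
def congr (e : Y ≃ₗ[Γ] Z) : TensL Γ S A Y ≃ₗ[S] TensL Γ S A Z :=
  LinearEquiv.ofLinearMap (map S A e.toLinearMap) (map S A e.symm.toLinearMap)
    (LinearMap.ext fun t => by
      refine (RTensor.map_map Γ _ _ _ _ t).trans ?_
      simpa using! DFunLike.congr_fun (RTensor.map_id Γ) t)
    (LinearMap.ext fun t => by
      refine (RTensor.map_map Γ _ _ _ _ t).trans ?_
      simpa using! DFunLike.congr_fun (RTensor.map_id Γ) t)

end TensL

namespace TensR

variable (Γ S B : Type u) [Ring Γ] [Ring S] {X Y Z : Type u} [AddCommGroup B] [Module Γ B]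
  [Module S B] [SMulCommClass S Γ B] [AddCommGroup X] [Module Γᵐᵒᵖ X] [AddCommGroup Y]
  [Module Γᵐᵒᵖ Y] [AddCommGroup Z] [Module Γᵐᵒᵖ Z]

instance : AddCommGroup (TensR Γ S X B) := inferInstanceAs (AddCommGroup (RTensor Γ X B))

/-- The action of `S` on `X ⊗_Γ B`. -/
def action : S →+* AddMonoid.End (TensR Γ S X B) where
  toFun a := RTensor.map Γ LinearMap.id (Module.toModuleEnd Γ B a)
  map_one' := RTensor.hom_ext Γ fun x y => congrArg (RTensor.tmul Γ x) (one_smul S y)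
  map_mul' a b := RTensor.hom_ext Γ fun x y => congrArg (RTensor.tmul Γ x) (mul_smul a b y)
  map_zero' := RTensor.hom_ext Γ fun x y =>
    (congrArg (RTensor.tmul Γ x) (zero_smul S y)).trans (RTensor.tmul_zero Γ x)
  map_add' a b := RTensor.hom_ext Γ fun x y =>
    (congrArg (RTensor.tmul Γ x) (add_smul a b y)).trans
      (RTensor.tmul_add Γ x (a • y) (b • y))

instance : Module S (TensR Γ S X B) := Module.compHom _ (action Γ S B (X := X))

/-- The elementary tensor `x ⊗ b`. -/
abbrev tmul (x : X) (b : B) : TensR Γ S X B := RTensor.tmul Γ x b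

variable {Γ S B}

theorem smul_tmul (s : S) (x : X) (b : B) : s • tmul Γ S B x b = tmul Γ S B x (s • b) := rfl

/-- An additive map on `X ⊗_Γ B` which is compatible with `S` on elementary tensors. -/
def mkLinear {G : Type u} [AddCommGroup G] [Module S G] (f : RTensor Γ X B →+ G)
    (h : ∀ (s : S) x b, f (RTensor.tmul Γ x (s • b)) = s • f (RTensor.tmul Γ x b)) :
    TensR Γ S X B →ₗ[S] G where
  toFun := f
  map_add' := map_add f
  map_smul' s t := by
    have : f.comp (action Γ S B s) = (DistribSMul.toAddMonoidHom G s).comp f :=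
      RTensor.hom_ext Γ fun x b => h s x b
    exact DFunLike.congr_fun this t

variable (S B) in
/-- The map `g ⊗ 1`. -/
def map (g : Y →ₗ[Γᵐᵒᵖ] Z) : TensR Γ S Y B →ₗ[S] TensR Γ S Z B :=
  mkLinear (RTensor.map Γ g .id) fun _ _ _ => rfl

theorem map_surjective {g : Y →ₗ[Γᵐᵒᵖ] Z} (hg : Function.Surjective g) :
    Function.Surjective (map S B g) :=
  RTensor.map_surjective Γ hg Function.surjective_id

theorem map_exact {f : X →ₗ[Γᵐᵒᵖ] Y} {g : Y →ₗ[Γᵐᵒᵖ] Z} (hg : Function.Surjective g)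
    (h : Function.Exact f g) : Function.Exact (map S B f) (map S B g) :=
  RTensor.exact_map_left Γ B hg h

theorem pdlt_of_projective [Module.Projective Γᵐᵒᵖ X] {n : ℕ} (h : PDLT S B n) :
    PDLT S (TensR Γ S X B) n := by
  obtain ⟨s, hs⟩ := Module.projective_def'.1 (inferInstance : Module.Projective Γᵐᵒᵖ X)
  refine PDLT.of_retract (mkLinear (RTensor.coordLeft Γ s) fun a x y => ?_)
    { toFun := RTensor.ofCoordLeft Γ id
      map_add' := map_add _
      map_smul' := fun a c => ?_ }
    (RTensor.ofCoordLeft_coordLeft Γ s id (LinearMap.congr_fun hs)) (h.finsupp X)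
  · ext i
    exact (smul_comm a (s x i).unop y).symm
  · have : (RTensor.ofCoordLeft Γ id).comp (DistribSMul.toAddMonoidHom (X →₀ B) a) =
        (RTensor.map Γ (.id : X →ₗ[Γᵐᵒᵖ] X) (Module.toModuleEnd Γ B a)).comp
          (RTensor.ofCoordLeft Γ id) := Finsupp.addHom_ext fun i x => by
      simp
    exact DFunLike.congr_fun this c

/-- `X ⊗_Γ B` does not depend on the module `X` up to isomorphism. -/
def congr (e : Y ≃ₗ[Γᵐᵒᵖ] Z) : TensR Γ S Y B ≃ₗ[S] TensR Γ S Z B :=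
  LinearEquiv.ofLinearMap (map S B e.toLinearMap) (map S B e.symm.toLinearMap)
    (LinearMap.ext fun t => by
      refine (RTensor.map_map Γ _ _ _ _ t).trans ?_
      simpa using! DFunLike.congr_fun (RTensor.map_id Γ) t)
    (LinearMap.ext fun t => by
      refine (RTensor.map_map Γ _ _ _ _ t).trans ?_
      simpa using! DFunLike.congr_fun (RTensor.map_id Γ) t)

end TensR

/-! ### Vanishing of Tor -/

section Tor

variable (Γ : Type u) [Ring Γ]

/-- The vanishing of `Tor_{n+1}^Γ(A, X)`, in terms of iterated syzygies of `A`. -/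
def TorVanish : ℕ → (A X : Type u) → [AddCommGroup A] → [Module Γᵐᵒᵖ A] → [AddCommGroup X] →
    [Module Γ X] → Prop
  | 0, A, X, _, _, _, _ => Function.Injective
      (RTensor.map Γ (Syz.incl Γᵐᵒᵖ A) (.id : X →ₗ[Γ] X))
  | n + 1, A, X, _, _, _, _ => TorVanish n (Syz Γᵐᵒᵖ A) X

variable {A B K L P Q : Type u} [AddCommGroup A] [Module Γᵐᵒᵖ A] [AddCommGroup K]
  [Module Γᵐᵒᵖ K] [AddCommGroup P] [Module Γᵐᵒᵖ P] [AddCommGroup B] [Module Γ B]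
  [AddCommGroup L] [Module Γ L] [AddCommGroup Q] [Module Γ Q]

namespace RTensor

theorem map_left_map_right {A' B' : Type u} [AddCommGroup A'] [Module Γᵐᵒᵖ A'] [AddCommGroup B']
    [Module Γ B'] (f : A →ₗ[Γᵐᵒᵖ] A') (g : B →ₗ[Γ] B') (t : RTensor Γ A B) :
    map Γ f .id (map Γ .id g t) = map Γ .id g (map Γ f .id t) := by
  rw [map_map, map_map]
  rfl

/-- Balance of `Tor_1`: both conditions say that it vanishes on `(A, B)`. The proof is a chase in
the three-by-three diagram of tensor products of the two sequences, where flatness of `P` and `Q`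
supplies the injective maps. -/
theorem injective_map_iff {i : K →ₗ[Γᵐᵒᵖ] P} {f : P →ₗ[Γᵐᵒᵖ] A} {j : L →ₗ[Γ] Q} {g : Q →ₗ[Γ] B}
    (hf : Function.Surjective f) (hif : Function.Exact i f) (hi : Function.Injective i)
    (hg : Function.Surjective g) (hjg : Function.Exact j g) (hj : Function.Injective j)
    [Module.Projective Γᵐᵒᵖ P] [Module.Projective Γ Q] :
    Function.Injective (map Γ i (.id : B →ₗ[Γ] B)) ↔
      Function.Injective (map Γ (.id : A →ₗ[Γᵐᵒᵖ] A) j) := by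
  simp only [injective_iff_map_eq_zero]
  constructor
  · intro h t ht
    obtain ⟨s, rfl⟩ := map_surjective Γ hf (g := .id) Function.surjective_id t
    rw [← map_left_map_right] at ht
    obtain ⟨r, hr⟩ := (exact_map_left Γ Q hf hif _).1 ht
    have h1 : map Γ i .id (map Γ .id g r) = 0 := by
      rw [map_left_map_right, hr]
      exact (exact_map_right Γ P hg hjg).apply_apply_eq_zero s
    obtain ⟨q, rfl⟩ := (exact_map_right Γ K hg hjg _).1 (h _ h1)
    rw [map_left_map_right] at hr
    rw [← map_injective_of_projective_left Γ hj hr]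
    exact (exact_map_left Γ L hf hif).apply_apply_eq_zero q
  · intro h t ht
    obtain ⟨s, rfl⟩ := map_surjective Γ (f := .id) Function.surjective_id hg t
    rw [map_left_map_right] at ht
    obtain ⟨r, hr⟩ := (exact_map_right Γ P hg hjg _).1 ht
    have h1 : map Γ .id j (map Γ f .id r) = 0 := by
      rw [← map_left_map_right, hr]
      exact (exact_map_left Γ Q hf hif).apply_apply_eq_zero s
    obtain ⟨q, rfl⟩ := (exact_map_left Γ L hf hif _).1 (h _ h1)
    rw [← map_left_map_right] at hr
    rw [← map_injective_of_projective_right Γ hi hr]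
    exact (exact_map_right Γ K hg hjg).apply_apply_eq_zero q

/-- The map `K ⊗ L → P ⊗ Q` factors through `P ⊗ L` and through `K ⊗ Q`, and the second map of each
factorization is injective by flatness. This is balance one degree up, for `Tor_2`. -/
theorem injective_map_iff_of_projective {i : K →ₗ[Γᵐᵒᵖ] P} {j : L →ₗ[Γ] Q}
    (hi : Function.Injective i) (hj : Function.Injective j)
    [Module.Projective Γᵐᵒᵖ P] [Module.Projective Γ Q] :
    Function.Injective (map Γ i (.id : L →ₗ[Γ] L)) ↔
      Function.Injective (map Γ (.id : K →ₗ[Γᵐᵒᵖ] K) j) := by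
  have h1 := map_injective_of_projective_left Γ (X := P) hj
  have h2 := map_injective_of_projective_right Γ (Y := Q) hi
  rw [← h1.of_comp_iff, ← h2.of_comp_iff]
  exact iff_of_eq (congrArg _ (funext fun t => (map_left_map_right Γ i j t).symm))

end RTensor

namespace TorVanish

variable {Γ}

/-- By balance, `Tor_1` can be read off from any projective presentation of the second variable
instead of the free cover of the first. -/
theorem zero_iff_right {j : L →ₗ[Γ] Q} {g : Q →ₗ[Γ] B} (hg : Function.Surjective g)
    (hjg : Function.Exact j g) (hj : Function.Injective j) [Module.Projective Γ Q] :
    TorVanish Γ 0 A B ↔ Function.Injective (RTensor.map Γ (.id : A →ₗ[Γᵐᵒᵖ] A) j) :=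
  RTensor.injective_map_iff Γ freeCover_surjective Syz.exact
    Syz.incl_injective hg hjg hj

theorem zero_iff_left {i : K →ₗ[Γᵐᵒᵖ] P} {f : P →ₗ[Γᵐᵒᵖ] A} (hf : Function.Surjective f)
    (hif : Function.Exact i f) (hi : Function.Injective i) [Module.Projective Γᵐᵒᵖ P] :
    TorVanish Γ 0 A B ↔ Function.Injective (RTensor.map Γ i (.id : B →ₗ[Γ] B)) := by
  rw [zero_iff_right freeCover_surjective Syz.exact
    Syz.incl_injective]
  exact (RTensor.injective_map_iff Γ hf hif hi freeCover_surjective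
    Syz.exact Syz.incl_injective).symm

theorem succ_iff_right {j : L →ₗ[Γ] Q} {g : Q →ₗ[Γ] B} (hg : Function.Surjective g)
    (hjg : Function.Exact j g) (hj : Function.Injective j) [Module.Projective Γ Q] {n : ℕ} :
    TorVanish Γ (n + 1) A B ↔ TorVanish Γ n A L := by
  induction n generalizing A with
  | zero =>
    refine (zero_iff_right (A := Syz Γᵐᵒᵖ A) hg hjg hj).trans ?_
    exact (RTensor.injective_map_iff_of_projective Γ Syz.incl_injective hj).symm
  | succ n ih => exact ih (A := Syz Γᵐᵒᵖ A)

theorem succ_iff_left {i : K →ₗ[Γᵐᵒᵖ] P} {f : P →ₗ[Γᵐᵒᵖ] A} (hf : Function.Surjective f)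
    (hif : Function.Exact i f) (hi : Function.Injective i) [Module.Projective Γᵐᵒᵖ P] {n : ℕ} :
    TorVanish Γ (n + 1) A B ↔ TorVanish Γ n K B := by
  -- Shifting onto the second variable leaves the given presentation of `A` untouched, so the
  -- induction can run over syzygies of `B`.
  have key := fun (A : Type u) [AddCommGroup A] [Module Γᵐᵒᵖ A] (B : Type u) [AddCommGroup B]
    [Module Γ B] (n : ℕ) => succ_iff_right (Γ := Γ) (A := A) (B := B) (n := n) freeCover_surjective
    Syz.exact Syz.incl_injective
  induction n generalizing B with
  | zero =>
    rw [key, zero_iff_left hf hif hi, zero_iff_right freeCover_surjective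
      Syz.exact Syz.incl_injective]
    exact RTensor.injective_map_iff_of_projective Γ hi Syz.incl_injective
  | succ n ih => exact (key A B (n + 1)).trans ((ih (B := Syz Γ B)).trans (key K B n).symm)

/-- The indices are both shifted by one: projective dimension at most `m` kills `Tor_{n+1}` for `n ≥
m`. -/
theorem of_pdlt {m n : ℕ} (hmn : m ≤ n) (h : PDLT Γᵐᵒᵖ A (m + 1)) : TorVanish Γ n A B := by
  induction n generalizing A m with
  | zero =>
    obtain rfl : m = 0 := by lia
    have := PDLT.one_iff.1 h
    rw [zero_iff_right freeCover_surjective Syz.exact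
      Syz.incl_injective]
    exact RTensor.map_injective_of_projective_left Γ Syz.incl_injective
  | succ n ih =>
    exact ih le_rfl (PDLT.syzygy Syz.incl_injective freeCover_surjective
      Syz.exact (h.mono (by lia)))

theorem of_projective_right [Module.Projective Γ B] {n : ℕ} : TorVanish Γ n A B := by
  induction n generalizing A with
  | zero => exact RTensor.map_injective_of_projective_right Γ Syz.incl_injective
  | succ n ih => exact ih

/-- Resolving `B` makes the criterion visibly natural in `A`: a kernel element dies in both
components, and the decomposition of the identity reassembles it from them. -/
theorem of_decomp_left {A₁ A₂ : Type u} [AddCommGroup A₁] [Module Γᵐᵒᵖ A₁] [AddCommGroup A₂]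
    [Module Γᵐᵒᵖ A₂] {p₁ : A →ₗ[Γᵐᵒᵖ] A₁} {i₁ : A₁ →ₗ[Γᵐᵒᵖ] A} {p₂ : A →ₗ[Γᵐᵒᵖ] A₂}
    {i₂ : A₂ →ₗ[Γᵐᵒᵖ] A} (h : i₁ ∘ₗ p₁ + i₂ ∘ₗ p₂ = .id) {n : ℕ} (h₁ : TorVanish Γ n A₁ B)
    (h₂ : TorVanish Γ n A₂ B) : TorVanish Γ n A B := by
  induction n generalizing B with
  | zero =>
    rw [zero_iff_right freeCover_surjective Syz.exact
      Syz.incl_injective, injective_iff_map_eq_zero] at h₁ h₂ ⊢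
    intro t ht
    have e₁ := h₁ (RTensor.map Γ p₁ .id t) (by rw [← RTensor.map_left_map_right, ht, map_zero])
    have e₂ := h₂ (RTensor.map Γ p₂ .id t) (by rw [← RTensor.map_left_map_right, ht, map_zero])
    have e₃ : RTensor.map Γ i₁ .id (RTensor.map Γ p₁ .id t) +
        RTensor.map Γ i₂ .id (RTensor.map Γ p₂ .id t) = t := by
      rw [RTensor.map_map, RTensor.map_map, LinearMap.id_comp, ← AddMonoidHom.add_apply,
        ← RTensor.map_add_left, h, RTensor.map_id]
      rfl
    rw [← e₃, e₁, e₂, map_zero, map_zero, add_zero]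
  | succ n ih =>
    rw [succ_iff_right freeCover_surjective Syz.exact
      Syz.incl_injective] at h₁ h₂ ⊢
    exact ih h₁ h₂

theorem of_decomp_right {B₁ B₂ : Type u} [AddCommGroup B₁] [Module Γ B₁] [AddCommGroup B₂]
    [Module Γ B₂] {p₁ : B →ₗ[Γ] B₁} {i₁ : B₁ →ₗ[Γ] B} {p₂ : B →ₗ[Γ] B₂}
    {i₂ : B₂ →ₗ[Γ] B} (h : i₁ ∘ₗ p₁ + i₂ ∘ₗ p₂ = .id) {n : ℕ} (h₁ : TorVanish Γ n A B₁)
    (h₂ : TorVanish Γ n A B₂) : TorVanish Γ n A B := by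
  induction n generalizing A with
  | zero =>
    refine (injective_iff_map_eq_zero _).2 fun t ht => ?_
    have e₁ := (injective_iff_map_eq_zero _).1 h₁ (RTensor.map Γ .id p₁ t)
      (by rw [RTensor.map_left_map_right, ht, map_zero])
    have e₂ := (injective_iff_map_eq_zero _).1 h₂ (RTensor.map Γ .id p₂ t)
      (by rw [RTensor.map_left_map_right, ht, map_zero])
    have e₃ : RTensor.map Γ .id i₁ (RTensor.map Γ .id p₁ t) +
        RTensor.map Γ .id i₂ (RTensor.map Γ .id p₂ t) = t := by
      rw [RTensor.map_map, RTensor.map_map, LinearMap.id_comp, ← AddMonoidHom.add_apply,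
        ← RTensor.map_add_right, h, RTensor.map_id]
      rfl
    rw [← e₃, e₁, e₂, map_zero, map_zero, add_zero]
  | succ n ih => exact ih h₁ h₂

end TorVanish

/-- A kernel element lifts to a cycle in `P₁ ⊗ B`; by exactness that cycle comes from `P₂ ⊗ B`,
hence is already zero in the image of `d₁` tensored with `B`. -/
theorem RTensor.injective_range_subtype {P₀ P₁ P₂ : Type u} [AddCommGroup P₀] [Module Γᵐᵒᵖ P₀]
    [AddCommGroup P₁] [Module Γᵐᵒᵖ P₁] [AddCommGroup P₂] [Module Γᵐᵒᵖ P₂]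
    {d₂ : P₂ →ₗ[Γᵐᵒᵖ] P₁} {d₁ : P₁ →ₗ[Γᵐᵒᵖ] P₀} (h : d₁ ∘ₗ d₂ = 0)
    (h' : Function.Exact (map Γ d₂ (.id : B →ₗ[Γ] B)) (map Γ d₁ (.id : B →ₗ[Γ] B))) :
    Function.Injective (map Γ (LinearMap.range d₁).subtype (.id : B →ₗ[Γ] B)) := by
  refine (injective_iff_map_eq_zero _).2 fun t ht => ?_
  obtain ⟨s, rfl⟩ := map_surjective Γ d₁.surjective_rangeRestrict
    (Function.surjective_id (α := B)) (f := d₁.rangeRestrict) (g := .id) t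
  rw [map_map] at ht
  obtain ⟨r, rfl⟩ := (h' s).1 ht
  have h1 : d₁.rangeRestrict ∘ₗ d₂ = 0 := by
    ext x
    exact LinearMap.congr_fun h x
  rw [map_map, h1, map_zero_left]
  rfl

/-- The images of the differentials in a projective resolution are syzygies of `A`. Vanishing
homology after tensoring makes their inclusions stay injective, and dimension shifting along the
resolution does the rest. -/
theorem TorVanish.of_isZero_torGroup
    (h : ∀ i : ℕ, 1 ≤ i → Limits.IsZero (TorGroup Γ i A B)) (n : ℕ) : TorVanish Γ n A B := by
  let R := ProjectiveResolution.of (ModuleCat.of Γᵐᵒᵖ A)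
  have hproj : ∀ n, Module.Projective Γᵐᵒᵖ (R.complex.X n) := fun n =>
    (IsProjective.iff_projective _).2 (R.projective n)
  have hB : ∀ n, Function.Exact
      (RTensor.map Γ (R.complex.d (n + 2) (n + 1)).hom (.id : B →ₗ[Γ] B))
      (RTensor.map Γ (R.complex.d (n + 1) n).hom (.id : B →ₗ[Γ] B)) := fun n => by
    have h1 : (((tensorFunctor Γ B).mapHomologicalComplex _).obj R.complex).ExactAt (n + 1) := by
      rw [HomologicalComplex.exactAt_iff_isZero_homology]
      exact (h (n + 1) (by lia)).of_iso (R.isoLeftDerivedObj (tensorFunctor Γ B) (n + 1)).symm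
    rw [HomologicalComplex.exactAt_iff' _ (n + 2) (n + 1) n (by simp) (by simp),
      ShortComplex.ab_exact_iff_function_exact] at h1
    exact h1
  have hex : ∀ n, Function.Exact (R.complex.d (n + 2) (n + 1)).hom
      (R.complex.d (n + 1) n).hom := fun n =>
    (ShortComplex.ShortExact.moduleCat_exact_iff_function_exact _).1 (R.exact_succ n)
  have hinj : ∀ n, Function.Injective (RTensor.map Γ
      (LinearMap.range (R.complex.d (n + 1) n).hom).subtype (.id : B →ₗ[Γ] B)) := fun n =>
    RTensor.injective_range_subtype Γ (hex n).linearMap_comp_eq_zero (hB n)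
  -- Each image is covered by the next projective term, with kernel the next image, so one degree of
  -- Tor is traded for one step in the resolution.
  have hZ : ∀ m n, TorVanish Γ m (LinearMap.range (R.complex.d (n + 1) n).hom) B := fun m => by
    have hses : ∀ n, Function.Exact (LinearMap.range (R.complex.d (n + 2) (n + 1)).hom).subtype
        (R.complex.d (n + 1) n).hom.rangeRestrict := fun n => by
      rw [LinearMap.exact_iff, LinearMap.ker_rangeRestrict, Submodule.range_subtype]
      exact (hex n).linearMap_ker_eq
    induction m with
    | zero => exact fun n => (TorVanish.zero_iff_left (LinearMap.surjective_rangeRestrict _)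
        (hses n) (Submodule.injective_subtype _)).2 (hinj (n + 1))
    | succ m ih => exact fun n => (TorVanish.succ_iff_left (LinearMap.surjective_rangeRestrict _)
        (hses n) (Submodule.injective_subtype _)).2 (ih (n + 1))
  let f : R.complex.X 0 →ₗ[Γᵐᵒᵖ] A := (R.π.f 0).hom
  have hf : Function.Surjective f :=
    (ModuleCat.epi_iff_surjective (R.π.f 0)).1 inferInstance
  have hif : Function.Exact (LinearMap.range (R.complex.d 1 0).hom).subtype f := by
    rw [LinearMap.exact_iff, Submodule.range_subtype]
    exact ((ShortComplex.ShortExact.moduleCat_exact_iff_function_exact _).1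
      R.exact₀).linearMap_ker_eq
  rcases n with _ | n
  · exact (TorVanish.zero_iff_left hf hif (Submodule.injective_subtype _)).2 (hinj 0)
  · exact (TorVanish.succ_iff_left hf hif (Submodule.injective_subtype _)).2 (hZ n 0)

variable {Γ} {S : Type u} [Ring S]

/-- When all higher Tor vanish, tensoring a projective resolution of `Y` with `B` stays exact and
its terms have projective dimension at most `c` over `S`; the two bounds add up. -/
theorem TensR.pdlt {Y : Type u} [AddCommGroup Y] [Module Γᵐᵒᵖ Y] [Module S B]
    [SMulCommClass S Γ B] (h : ∀ n, TorVanish Γ n Y B) {n c : ℕ}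
    (hY : PDLT Γᵐᵒᵖ Y (n + 1)) (hB : PDLT S B (c + 1)) :
    PDLT S (TensR Γ S Y B) (n + c + 1) := by
  induction n generalizing Y with
  | zero =>
    have := PDLT.one_iff.1 hY
    exact (pdlt_of_projective hB).mono (by lia)
  | succ n ih =>
    have h1 : PDLT S (TensR Γ S (Syz Γᵐᵒᵖ Y) B) (n + c + 1) :=
      ih (fun n => h (n + 1)) (PDLT.syzygy Syz.incl_injective freeCover_surjective
        Syz.exact hY)
    have h2 : PDLT S (TensR Γ S (FreeMod Γᵐᵒᵖ Y) B) (n + c + 1 + 1) :=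
      (pdlt_of_projective hB).mono (by lia)
    have h3 : Function.Injective (map S B (Syz.incl Γᵐᵒᵖ Y)) := h 0
    exact (PDLT.third h3 (map_surjective freeCover_surjective)
      (map_exact freeCover_surjective Syz.exact) h1 h2).mono (by lia)

theorem TensL.pdlt {Y : Type u} [AddCommGroup Y] [Module Γ Y] [Module S A]
    [SMulCommClass S Γᵐᵒᵖ A] (h : ∀ n, TorVanish Γ n A Y) {n c : ℕ}
    (hY : PDLT Γ Y (n + 1)) (hA : PDLT S A (c + 1)) :
    PDLT S (TensL Γ S A Y) (n + c + 1) := by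
  induction n generalizing Y with
  | zero =>
    have := PDLT.one_iff.1 hY
    exact (pdlt_of_projective hA).mono (by lia)
  | succ n ih =>
    have h1 : PDLT S (TensL Γ S A (Syz Γ Y)) (n + c + 1) :=
      ih (fun n => (TorVanish.succ_iff_right freeCover_surjective
        Syz.exact Syz.incl_injective).1 (h (n + 1)))
        (PDLT.syzygy Syz.incl_injective freeCover_surjective
        Syz.exact hY)
    have h2 : PDLT S (TensL Γ S A (FreeMod Γ Y)) (n + c + 1 + 1) :=
      (pdlt_of_projective hA).mono (by lia)
    have h3 : Function.Injective (map S A (Syz.incl Γ Y)) :=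
      (TorVanish.zero_iff_right freeCover_surjective Syz.exact
        Syz.incl_injective).1 (h 0)
    exact (PDLT.third h3 (map_surjective freeCover_surjective)
      (map_exact freeCover_surjective Syz.exact) h1 h2).mono (by lia)

end Tor

/-! ### Change of rings and finiteness of homological dimensions -/

section FinitisticDimension

theorem lt_top_iff_exists_le_nat {x : WithBot ℕ∞} : x < ⊤ ↔ ∃ n : ℕ, x ≤ n := by
  constructor
  · intro h
    induction x with
    | bot => exact ⟨0, bot_le⟩
    | coe x =>
      lift x to ℕ using (WithBot.coe_lt_coe.1 h).ne
      exact ⟨x, le_rfl⟩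
  · rintro ⟨n, hn⟩
    exact hn.trans_lt (WithBot.coe_lt_coe.2 (ENat.natCast_lt_top n))

variable {R : Type u} [Ring R]

theorem littleFinitisticDim_lt_top_iff : littleFinitisticDim R < ⊤ ↔
    ∃ n : ℕ, ∀ X : ModuleCat.{u} R, Module.Finite R X → projectiveDimension X < ⊤ →
      PDLT R X (n + 1) := by
  simp only [littleFinitisticDim, lt_top_iff_exists_le_nat, iSup_le_iff,
    projectiveDimension_le_iff]

theorem bigFinitisticDim_lt_top_iff : bigFinitisticDim R < ⊤ ↔
    ∃ n : ℕ, ∀ X : ModuleCat.{u} R, projectiveDimension X < ⊤ → PDLT R X (n + 1) := by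
  simp only [bigFinitisticDim, lt_top_iff_exists_le_nat, iSup_le_iff, projectiveDimension_le_iff]

theorem globalDim_lt_top_iff : globalDim R < ⊤ ↔
    ∃ n : ℕ, ∀ X : ModuleCat.{u} R, PDLT R X (n + 1) := by
  simp only [globalDim, lt_top_iff_exists_le_nat, iSup_le_iff, projectiveDimension_le_iff]

end FinitisticDimension

/-- `A ⊗_R -` reflects projectivity of modules `X` with `Tor_1^R(A, X) = 0`. -/
def ReflectsProjective (R S A : Type u) [Ring R] [Ring S] [AddCommGroup A] [Module S A]
    [Module Rᵐᵒᵖ A] [SMulCommClass S Rᵐᵒᵖ A] : Prop :=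
  ∀ (X : Type u) [AddCommGroup X] [Module R X], TorVanish R 0 A X →
    Module.Projective S (TensL R S A X) → Module.Projective R X

namespace ReflectsProjective

variable {R S A : Type u} [Ring R] [Ring S] [AddCommGroup A] [Module S A] [Module Rᵐᵒᵖ A]
  [SMulCommClass S Rᵐᵒᵖ A] [Module.Projective S A]

/-- Tor vanishing turns the free cover sequence of `X` into a projective presentation over `S`, so
syzygies on the two sides correspond; the last one is projective by reflection. -/
theorem pdlt (hA : ReflectsProjective R S A) {X : Type u} [AddCommGroup X] [Module R X]
    (h : ∀ n, TorVanish R n A X) {n : ℕ} (hX : PDLT S (TensL R S A X) (n + 1)) :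
    PDLT R X (n + 1) := by
  induction n generalizing X with
  | zero => exact PDLT.one_iff.2 (hA X (h 0) (PDLT.one_iff.1 hX))
  | succ n ih =>
    have h1 : Function.Injective (TensL.map S A (Syz.incl R X)) :=
      (TorVanish.zero_iff_right freeCover_surjective Syz.exact Syz.incl_injective).1 (h 0)
    have h2 : Module.Projective S (TensL R S A (FreeMod R X)) := TensL.projective
    refine PDLT.third Syz.incl_injective freeCover_surjective Syz.exact (ih (fun n => ?_) ?_)
      PDLT.of_projective
    · exact (TorVanish.succ_iff_right freeCover_surjective Syz.exact Syz.incl_injective).1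
        (h (n + 1))
    · exact PDLT.syzygy h1 (TensL.map_surjective freeCover_surjective)
        (TensL.map_exact freeCover_surjective Syz.exact) hX

theorem pdlt_of_forall (hA : ReflectsProjective R S A) {d : ℕ} (hd : PDLT Rᵐᵒᵖ A (d + 1))
    {p : ModuleCat.{u} R → Prop}
    (hp : ∀ X, p X → ∃ (L Q : ModuleCat.{u} R) (j : L →ₗ[R] Q) (g : Q →ₗ[R] X), p L ∧
      Module.Projective R Q ∧ Function.Injective j ∧ Function.Surjective g ∧ Function.Exact j g)
    {f : ℕ} (hf : ∀ X, p X → (∀ n, TorVanish R n A X) → PDLT S (TensL R S A X) (f + 1))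
    (X : ModuleCat.{u} R) (hX : p X) : PDLT R X (f + d + 1) := by
  -- Tor vanishes from index `e` on; a syzygy lowers `e` by one and costs one in the bound. The
  -- start `e = d` is allowed because `A` has projective dimension at most `d`.
  have key : ∀ (e : ℕ) (X : ModuleCat.{u} R), p X → (∀ n, e ≤ n → TorVanish R n A X) →
      PDLT R X (f + e + 1) := fun e => by
    induction e with
    | zero => exact fun X hX h => hA.pdlt (fun n => h n n.zero_le) (hf X hX fun n => h n n.zero_le)
    | succ e ih =>
      intro X hX h
      obtain ⟨L, Q, j, g, hL, hQ, hj, hg, hjg⟩ := hp X hX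
      refine PDLT.third hj hg hjg (ih L hL fun n hn => ?_) PDLT.of_projective
      exact (TorVanish.succ_iff_right hg hjg hj).1 (h (n + 1) (by lia))
  exact key d X hX fun n hn => TorVanish.of_pdlt hn hd

theorem globalDim_lt_top (hA : ReflectsProjective R S A)
    (hd : projectiveDimension (ModuleCat.of Rᵐᵒᵖ A) < ⊤) (h : globalDim S < ⊤) :
    globalDim R < ⊤ := by
  obtain ⟨d, hd⟩ := PDLT.lt_top_iff.1 hd
  obtain ⟨f, hf⟩ := globalDim_lt_top_iff.1 h
  exact globalDim_lt_top_iff.2 ⟨f + d, fun X => hA.pdlt_of_forall hd (p := fun _ => True)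
    (fun X _ => ⟨.of R (Syz R X), .of R (FreeMod R X), Syz.incl R X, freeCover R X, trivial,
      inferInstanceAs (Module.Projective R (FreeMod R X)), Syz.incl_injective,
      freeCover_surjective, Syz.exact⟩) (fun X _ _ => hf (.of S (TensL R S A X))) X trivial⟩

theorem pd_tensL_lt_top {X : ModuleCat.{u} R} (hX : projectiveDimension X < ⊤)
    (h : ∀ n, TorVanish R n A X) :
    projectiveDimension (ModuleCat.of S (TensL R S A X)) < ⊤ := by
  obtain ⟨m, hm⟩ := PDLT.lt_top_iff.1 hX
  exact PDLT.lt_top_iff.2 ⟨_, TensL.pdlt (c := 0) h hm PDLT.of_projective⟩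

theorem _root_.pd_kernel_lt_top {K P X : Type u} [AddCommGroup K] [Module R K] [AddCommGroup P]
    [Module R P] [AddCommGroup X] [Module R X] {f : K →ₗ[R] P} {g : P →ₗ[R] X}
    (hf : Function.Injective f) (hg : Function.Surjective g) (h : Function.Exact f g)
    [Module.Projective R P] (hX : projectiveDimension (ModuleCat.of R X) < ⊤) :
    projectiveDimension (ModuleCat.of R K) < ⊤ := by
  obtain ⟨m, hm⟩ := PDLT.lt_top_iff.1 hX
  exact PDLT.lt_top_iff.2 ⟨m, PDLT.syzygy hf hg h (hm.mono (by lia))⟩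

theorem bigFinitisticDim_lt_top (hA : ReflectsProjective R S A)
    (hd : projectiveDimension (ModuleCat.of Rᵐᵒᵖ A) < ⊤) (h : bigFinitisticDim S < ⊤) :
    bigFinitisticDim R < ⊤ := by
  obtain ⟨d, hd⟩ := PDLT.lt_top_iff.1 hd
  obtain ⟨f, hf⟩ := bigFinitisticDim_lt_top_iff.1 h
  exact bigFinitisticDim_lt_top_iff.2 ⟨f + d, fun X hX => hA.pdlt_of_forall hd
    (p := fun X => projectiveDimension X < ⊤)
    (fun X hX => ⟨.of R (Syz R X), .of R (FreeMod R X), Syz.incl R X, freeCover R X,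
      pd_kernel_lt_top Syz.incl_injective freeCover_surjective Syz.exact hX,
      inferInstanceAs (Module.Projective R (FreeMod R X)), Syz.incl_injective,
      freeCover_surjective, Syz.exact⟩)
    (fun X hX h => hf (.of S (TensL R S A X)) (pd_tensL_lt_top hX h)) X hX⟩

/-- The Noetherian hypothesis keeps syzygies finitely generated, and finiteness of `A` over `S`
keeps the tensor products finitely generated. -/
theorem littleFinitisticDim_lt_top [IsNoetherianRing R] [Module.Finite S A]
    (hA : ReflectsProjective R S A)
    (hd : projectiveDimension (ModuleCat.of Rᵐᵒᵖ A) < ⊤) (h : littleFinitisticDim S < ⊤) :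
    littleFinitisticDim R < ⊤ := by
  obtain ⟨d, hd⟩ := PDLT.lt_top_iff.1 hd
  obtain ⟨f, hf⟩ := littleFinitisticDim_lt_top_iff.1 h
  refine littleFinitisticDim_lt_top_iff.2 ⟨f + d, fun X hX hX' => hA.pdlt_of_forall hd
    (p := fun X => Module.Finite R X ∧ projectiveDimension X < ⊤) (fun X ⟨hX, hX'⟩ => ?_)
    (fun X ⟨hX, hX'⟩ h => hf (.of S (TensL R S A X)) TensL.finite
      (pd_tensL_lt_top hX' h)) X ⟨hX, hX'⟩⟩
  obtain ⟨n, g, hg⟩ := Module.Finite.exists_fin' R X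
  have hex : Function.Exact (LinearMap.ker g).subtype g := LinearMap.exact_subtype_ker_map g
  exact ⟨.of R (LinearMap.ker g), .of R (Fin n → R), (LinearMap.ker g).subtype, g,
    ⟨inferInstanceAs (Module.Finite R (LinearMap.ker g)),
      pd_kernel_lt_top (Submodule.injective_subtype _) hg hex hX'⟩,
    inferInstanceAs (Module.Projective R (Fin n → R)), Submodule.injective_subtype _, hg, hex⟩

end ReflectsProjective

/-! ### Split extensions: bimodule structures and reflection of projectivity -/

section SplitExtension

variable {Γ M : Type u} [Ring Γ] [AddCommGroup M] [Module Γ M] [Module Γᵐᵒᵖ M]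
  [SMulCommClass Γ Γᵐᵒᵖ M]

namespace SplitExtension

variable (θ : BimoduleMul Γ M)

/-- The inclusion `Γ → Γ ⋉_θ M`. -/
def inl : Γ →+* SplitExtension θ where
  toFun γ := ⟨γ, 0⟩
  map_one' := rfl
  map_mul' a b := by ext <;> simp
  map_zero' := rfl
  map_add' a b := by ext <;> simp

/-- The projection `Γ ⋉_θ M → Γ`. -/
def fstHom : SplitExtension θ →+* Γ where
  toFun := fst
  map_one' := rfl
  map_mul' _ _ := rfl
  map_zero' := rfl
  map_add' _ _ := rfl

@[simp] theorem fst_inl (γ : Γ) : (inl θ γ).fst = γ := rfl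
@[simp] theorem snd_inl (γ : Γ) : (inl θ γ).snd = 0 := rfl

variable {θ}

instance : Module Γ (SplitExtension θ) := Module.compHom _ (inl θ)
instance : Module Γᵐᵒᵖ (SplitExtension θ) := Module.compHom _ (inl θ).op
instance : Module (SplitExtension θ) Γ := Module.compHom _ (fstHom θ)
instance : Module (SplitExtension θ)ᵐᵒᵖ Γ := Module.compHom _ (fstHom θ).op

theorem smul_eq (γ : Γ) (a : SplitExtension θ) : γ • a = inl θ γ * a := rfl
theorem op_smul_eq (γ : Γᵐᵒᵖ) (a : SplitExtension θ) : γ • a = a * inl θ γ.unop := rfl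
theorem op_smul_base_eq (a : (SplitExtension θ)ᵐᵒᵖ) (γ : Γ) : a • γ = γ * a.unop.fst := rfl

@[simp] theorem fst_smul (γ : Γ) (a : SplitExtension θ) : (γ • a).fst = γ * a.fst := rfl
@[simp] theorem snd_smul (γ : Γ) (a : SplitExtension θ) : (γ • a).snd = γ • a.snd := by
  simp [smul_eq]
@[simp] theorem fst_op_smul (γ : Γᵐᵒᵖ) (a : SplitExtension θ) :
    (γ • a).fst = a.fst * γ.unop := rfl
@[simp] theorem snd_op_smul (γ : Γᵐᵒᵖ) (a : SplitExtension θ) : (γ • a).snd = γ • a.snd := by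
  simp [op_smul_eq]

instance : SMulCommClass Γ Γᵐᵒᵖ (SplitExtension θ) :=
  ⟨fun a b c => (mul_assoc (inl θ a) c (inl θ b.unop)).symm⟩
instance : SMulCommClass (SplitExtension θ) Γᵐᵒᵖ (SplitExtension θ) :=
  ⟨fun a b c => (mul_assoc a c (inl θ b.unop)).symm⟩
instance : SMulCommClass (SplitExtension θ)ᵐᵒᵖ Γ (SplitExtension θ) :=
  ⟨fun a b c => mul_assoc (inl θ b) c a.unop⟩
instance : SMulCommClass Γ (SplitExtension θ)ᵐᵒᵖ Γ :=
  ⟨fun a b c => (mul_assoc a c b.unop.fst).symm⟩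

/-- `Γ ⊗_{Γ ⋉ M} (Γ ⋉ M) ⊗_Γ X` has `X` as a retract. -/
theorem reflectsProjective_self :
    ReflectsProjective Γ (SplitExtension θ) (SplitExtension θ) := by
  intro X _ _ _ hX
  have hP : Module.Projective Γ (TensL (SplitExtension θ) Γ Γ
    (TensL Γ (SplitExtension θ) (SplitExtension θ) X)) := TensL.projective
  let r₀ : TensL Γ (SplitExtension θ) (SplitExtension θ) X →+ X := RTensor.lift Γ
    (AddMonoidHom.mk' (fun e => (DistribSMul.toAddMonoidHom X e.fst))
      (fun a b => by ext; simp [add_smul]))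
    (fun e γ x => by simp [mul_smul])
  have hr₀ : ∀ (e : SplitExtension θ)
      (t : TensL Γ (SplitExtension θ) (SplitExtension θ) X), r₀ (e • t) = e.fst • r₀ t :=
    fun e t => by
      have : r₀.comp (TensL.action Γ (SplitExtension θ) (SplitExtension θ) e) =
          (DistribSMul.toAddMonoidHom X e.fst).comp r₀ :=
        RTensor.hom_ext Γ fun a x => mul_smul e.fst a.fst x
      exact DFunLike.congr_fun this t
  -- The retraction sends `γ ⊗ (e ⊗ x)` to `γ · e.fst · x`; the section is `x ↦ 1 ⊗ (1 ⊗ x)`.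
  let r : TensL (SplitExtension θ) Γ Γ (TensL Γ (SplitExtension θ) (SplitExtension θ) X) →ₗ[Γ] X :=
    TensL.mkLinear (RTensor.lift (SplitExtension θ)
      (AddMonoidHom.mk' (fun γ => (DistribSMul.toAddMonoidHom X γ).comp r₀)
        (fun a b => AddMonoidHom.ext fun t => add_smul a b (r₀ t)))
      (fun γ e t => (mul_smul γ e.fst (r₀ t)).trans (congrArg (γ • ·) (hr₀ e t).symm)))
      (fun γ a t => mul_smul γ a (r₀ t))
  let i : X →ₗ[Γ] TensL (SplitExtension θ) Γ Γ
      (TensL Γ (SplitExtension θ) (SplitExtension θ) X) :=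
    { toFun := fun x => TensL.tmul (SplitExtension θ) Γ Γ 1
        (TensL.tmul Γ (SplitExtension θ) (SplitExtension θ) 1 x)
      map_add' := fun x y => by
        refine Eq.trans ?_ (RTensor.tmul_add _ _ _ _)
        exact congrArg _ (RTensor.tmul_add _ _ _ _)
      map_smul' := fun γ x => by
        have h1 : TensL.tmul Γ (SplitExtension θ) (SplitExtension θ) 1 (γ • x) =
            inl θ γ • TensL.tmul Γ (SplitExtension θ) (SplitExtension θ) 1 x := by
          rw [TensL.smul_tmul]
          refine (RTensor.smul_tmul Γ _ _ _).symm.trans ?_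
          rw [op_smul_eq, one_mul, smul_eq_mul, mul_one, unop_op]
        rw [h1]
        refine (RTensor.smul_tmul (SplitExtension θ) (1 : Γ) (inl θ γ) _).symm.trans ?_
        rw [op_smul_base_eq, RingHom.id_apply, TensL.smul_tmul]
        simp }
  refine Module.Projective.of_split i r (LinearMap.ext fun x => ?_)
  change (1 : Γ) • ((1 : SplitExtension θ).fst • x) = x
  simp

/-! ### Nakayama's lemma for the nilpotent ideal `0 ⊕ M` -/

section Nakayama

variable {X : Type u} [AddCommGroup X] [Module (SplitExtension θ) X]

variable (θ X) in
/-- The additive subgroup of `X` generated by all `(0, a) • x` with `a ∈ W`. -/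
def kerSMul (W : Set M) : AddSubgroup X :=
  AddSubgroup.closure {y | ∃ a ∈ W, ∃ x : X, y = (⟨0, a⟩ : SplitExtension θ) • x}

/-- There is a well-defined map from `Γ ⊗_E X` to `X / (0 ⊕ M)X` that sends `1 ⊗ x` to the class of
`x`. -/
theorem mem_kerSMul_univ_of_tmul_eq_zero (x : X)
    (h : RTensor.tmul (SplitExtension θ) (1 : Γ) x = 0) : x ∈ kerSMul θ X Set.univ := by
  let φ : RTensor (SplitExtension θ) Γ X →+ X ⧸ kerSMul θ X Set.univ :=
    RTensor.lift (SplitExtension θ)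
      (AddMonoidHom.mk' (fun γ => (QuotientAddGroup.mk' (kerSMul θ X Set.univ)).comp
        (DistribSMul.toAddMonoidHom X (inl θ γ))) (fun a b => by ext; simp [add_smul]))
      (fun γ e x => by
        refine (QuotientAddGroup.eq_iff_sub_mem).2 ?_
        have h1 : inl θ (γ * e.fst) - inl θ γ * e = ⟨0, -(γ • e.snd)⟩ := by
          rw [sub_eq_iff_eq_add]
          ext <;> simp
        simp only [DistribSMul.toAddMonoidHom_apply, op_smul_base_eq, unop_op]
        rw [smul_smul, ← sub_smul, h1]
        exact AddSubgroup.subset_closure ⟨_, trivial, x, rfl⟩)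
  have h1 : φ (RTensor.tmul (SplitExtension θ) (1 : Γ) x) = 0 := by rw [h, map_zero]
  have h2 := (QuotientAddGroup.eq_zero_iff _).1 h1
  simpa using h2

/-- Nakayama: substituting `X = N + (0 ⊕ M)X` into itself gives `X = N + (0 ⊕ im θ^r)X` for every
`r`, and the second term is zero once `θ^r = 0`. -/
theorem eq_top_of_nilpotent (hθ : θ.IsNilpotent) (N : Submodule (SplitExtension θ) X)
    (hN : ∀ x : X, ∃ y ∈ N, x - y ∈ kerSMul θ X Set.univ) : N = ⊤ := by
  have key : ∀ (r : ℕ) (x : X),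
      x ∈ N.toAddSubgroup ⊔ kerSMul θ X (Set.range (θ.iter r)) := fun r => by
    induction r with
    | zero =>
      intro x
      obtain ⟨y, hy, hxy⟩ := hN x
      have : Set.range (θ.iter 0) = Set.univ := Set.range_eq_univ.2 fun m => ⟨m, rfl⟩
      rw [this]
      exact AddSubgroup.mem_sup.2 ⟨y, hy, x - y, hxy, by abel⟩
    | succ r ih =>
      intro x
      suffices h : kerSMul θ X (Set.range (θ.iter r)) ≤
          N.toAddSubgroup ⊔ kerSMul θ X (Set.range (θ.iter (r + 1))) from
        (sup_le le_sup_left h) (ih x)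
      rw [kerSMul, AddSubgroup.closure_le]
      rintro _ ⟨_, ⟨t, rfl⟩, x, rfl⟩
      obtain ⟨y, hy, hxy⟩ := hN x
      rw [← add_sub_cancel y x, smul_add]
      refine add_mem (AddSubgroup.mem_sup_left (N.smul_mem _ hy)) (AddSubgroup.mem_sup_right ?_)
      generalize x - y = z at hxy
      induction hxy using AddSubgroup.closure_induction with
      | mem z hz =>
        obtain ⟨m, -, w, rfl⟩ := hz
        -- In `E` the product of `(0, θ^r t)` and `(0, m)` is `(0, θ^{r+1}(t ⊗ m))`.
        refine AddSubgroup.subset_closure ⟨_, ⟨RTensor.tmul Γ t m, rfl⟩, w, ?_⟩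
        rw [smul_smul]
        congr 1
        ext
        · simp
        · simp
          rfl
      | zero => rw [smul_zero]; exact zero_mem _
      | add a b _ _ ha hb => rw [smul_add]; exact add_mem ha hb
      | neg a _ ha => rw [smul_neg]; exact neg_mem ha
  obtain ⟨n, -, hn⟩ := hθ
  refine eq_top_iff.2 fun x _ => ?_
  have h := key n x
  have h0 : kerSMul θ X (Set.range (θ.iter n)) = ⊥ := by
    rw [eq_bot_iff, kerSMul, AddSubgroup.closure_le]
    rintro _ ⟨_, ⟨t, rfl⟩, x, rfl⟩
    rw [hn]
    exact zero_smul (SplitExtension θ) x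
  rw [h0, sup_bot_eq] at h
  exact h

end Nakayama

/-- Put `Y = Γ ⊗_E X`, projective over `Γ`. A `Γ`-linear section of `X → Y` extends to an `E`-linear
map from the projective module `E ⊗_Γ Y` to `X` that is an isomorphism after applying `Γ ⊗_E -`.
Nakayama makes it onto and, with `Tor_1` vanishing, injective. -/
theorem reflectsProjective_base (hθ : θ.IsNilpotent) :
    ReflectsProjective (SplitExtension θ) Γ Γ := by
  intro X _ _ hT hX
  let _ : Module Γ X := Module.compHom X (inl θ)
  have hγ : ∀ (γ : Γ) (x : X), γ • x = inl θ γ • x := fun _ _ => rfl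
  have hq1 : ∀ (γ : Γ) (x : X), RTensor.tmul (SplitExtension θ) γ x =
      RTensor.tmul (SplitExtension θ) (1 : Γ) (γ • x) := fun γ x => by
    rw [hγ, ← RTensor.smul_tmul, op_smul_base_eq]
    simp
  let q : X →ₗ[Γ] TensL (SplitExtension θ) Γ Γ X :=
    { toFun := fun x => TensL.tmul (SplitExtension θ) Γ Γ 1 x
      map_add' := fun x y => RTensor.tmul_add _ _ _ _
      map_smul' := fun γ x => by
        rw [RingHom.id_apply, TensL.smul_tmul, smul_eq_mul, mul_one]
        exact (hq1 γ x).symm }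
  have hq : Function.Surjective q := fun t => by
    induction t using RTensor.induction_on with
    | zero => exact ⟨0, map_zero q⟩
    | tmul γ x => exact ⟨γ • x, (hq1 γ x).symm⟩
    | add s t hs ht =>
      obtain ⟨x, rfl⟩ := hs
      obtain ⟨y, rfl⟩ := ht
      exact ⟨x + y, map_add q x y⟩
  obtain ⟨s, hs⟩ := Module.projective_lifting_property q .id hq
  have hqs : ∀ y, q (s y) = y := LinearMap.congr_fun hs
  let P := TensL Γ (SplitExtension θ) (SplitExtension θ) (TensL (SplitExtension θ) Γ Γ X)
  have hP : Module.Projective (SplitExtension θ) P := TensL.projective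
  let p : P →ₗ[SplitExtension θ] X := TensL.mkLinear (RTensor.lift Γ
      (AddMonoidHom.mk' (fun e => (DistribSMul.toAddMonoidHom X e).comp s.toAddMonoidHom)
        (fun a b => by ext; simp [add_smul]))
      (fun e γ y => by
        simp only [AddMonoidHom.mk'_apply, AddMonoidHom.comp_apply,
          DistribSMul.toAddMonoidHom_apply, LinearMap.toAddMonoidHom_coe, map_smul, hγ,
          op_smul_eq, unop_op, mul_smul]))
    (fun e a y => mul_smul e a (s y))
  have hp1 : ∀ y, p (TensL.tmul Γ (SplitExtension θ) (SplitExtension θ) 1 y) = s y :=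
    fun y => one_smul (SplitExtension θ) (s y)
  have hp : Function.Surjective p := by
    rw [← LinearMap.range_eq_top]
    refine eq_top_of_nilpotent hθ _ fun x => ⟨s (q x), ⟨_, hp1 _⟩, ?_⟩
    refine mem_kerSMul_univ_of_tmul_eq_zero _ ?_
    change q (x - s (q x)) = 0
    rw [map_sub, hqs, sub_self]
  -- Here the Tor hypothesis enters: `P` is projective over `E`, so the kernel of `p` is a syzygy of
  -- `X`.
  have hker : Function.Injective (RTensor.map (SplitExtension θ) (.id : Γ →ₗ[_] Γ)
      (LinearMap.ker p).subtype) :=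
    (TorVanish.zero_iff_right hp (LinearMap.exact_subtype_ker_map p)
      (Submodule.injective_subtype _)).1 hT
  -- Every element of `Γ ⊗_E E ⊗_Γ Y` has the form `1 ⊗ (1 ⊗ y)`, and `1 ⊗ p` sends it to `y`; this
  -- gives injectivity of `1 ⊗ p`.
  have helt : ∀ t : RTensor (SplitExtension θ) Γ P, ∃ y, t = RTensor.tmul (SplitExtension θ)
      (1 : Γ) (TensL.tmul Γ (SplitExtension θ) (SplitExtension θ) 1 y : P) := fun t => by
    have hadd : ∀ y y', TensL.tmul Γ (SplitExtension θ) (SplitExtension θ) 1 (y + y') =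
        TensL.tmul Γ (SplitExtension θ) (SplitExtension θ) 1 y +
        TensL.tmul Γ (SplitExtension θ) (SplitExtension θ) 1
          (y' : TensL (SplitExtension θ) Γ Γ X) := fun y y' => RTensor.tmul_add _ _ _ _
    induction t using RTensor.induction_on with
    | zero => exact ⟨0, (RTensor.tmul_zero (SplitExtension θ) (1 : Γ)).symm.trans
        (congrArg _ (RTensor.tmul_zero Γ _).symm)⟩
    | add s t hs ht =>
      obtain ⟨y, rfl⟩ := hs
      obtain ⟨y', rfl⟩ := ht
      exact ⟨y + y', by rw [hadd, RTensor.tmul_add]⟩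
    | tmul γ z =>
      induction z using RTensor.induction_on with
      | zero => exact ⟨0, (RTensor.tmul_zero (SplitExtension θ) γ).trans
          ((RTensor.tmul_zero (SplitExtension θ) (1 : Γ)).symm.trans
          (congrArg _ (RTensor.tmul_zero Γ _).symm))⟩
      | add s t hs ht =>
        obtain ⟨y, hy⟩ := hs
        obtain ⟨y', hy'⟩ := ht
        refine ⟨y + y', ?_⟩
        rw [hadd, RTensor.tmul_add, ← hy, ← hy']
        exact RTensor.tmul_add _ _ _ _
      | tmul e y =>
        refine ⟨(γ * e.fst) • y, ?_⟩
        have h1 : (RTensor.tmul Γ e y : P) =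
            e • TensL.tmul Γ (SplitExtension θ) (SplitExtension θ) 1 y := by
          rw [TensL.smul_tmul, smul_eq_mul, mul_one]
        have h2 : TensL.tmul Γ (SplitExtension θ) (SplitExtension θ) 1 ((γ * e.fst) • y) =
            inl θ (γ * e.fst) • TensL.tmul Γ (SplitExtension θ) (SplitExtension θ) 1 y := by
          rw [TensL.smul_tmul, smul_eq_mul, mul_one]
          refine (RTensor.smul_tmul Γ _ _ _).symm.trans ?_
          rw [op_smul_eq, one_mul, unop_op]
        rw [h1, h2, ← RTensor.smul_tmul, ← RTensor.smul_tmul, op_smul_base_eq, op_smul_base_eq]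
        simp
  have hinj : Function.Injective p := by
    rw [← LinearMap.ker_eq_bot, ← Submodule.subsingleton_iff_eq_bot]
    rw [← Submodule.subsingleton_iff (SplitExtension θ), ← subsingleton_iff_bot_eq_top]
    -- Nakayama for the zero submodule of the kernel: it suffices that `1 ⊗ k = 0` for all `k`,
    -- which is tested in `Γ ⊗_E P`.
    refine eq_top_of_nilpotent hθ _ fun k => ⟨0, zero_mem _, ?_⟩
    rw [sub_zero]
    refine mem_kerSMul_univ_of_tmul_eq_zero _ (hker ?_)
    rw [map_zero]
    obtain ⟨y, hy⟩ := helt (RTensor.map (SplitExtension θ) .id (LinearMap.ker p).subtype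
      (RTensor.tmul (SplitExtension θ) (1 : Γ) k))
    have h1 := congrArg (RTensor.map (SplitExtension θ) (.id : Γ →ₗ[_] Γ) p) hy
    have h2 : p (k : P) = 0 := k.2
    simp only [RTensor.map_tmul, Submodule.subtype_apply, h2, LinearMap.id_apply,
      RTensor.tmul_zero, hp1] at h1
    have h3 : y = 0 := by
      rw [← hqs y]
      exact h1.symm
    rw [hy, h3]
    exact (congrArg _ (RTensor.tmul_zero Γ _)).trans (RTensor.tmul_zero _ _)
  exact Module.Projective.of_equiv (LinearEquiv.ofBijective p ⟨hinj, hp⟩)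

end SplitExtension

end SplitExtension

/-! ### Projective dimension of modules over a split extension -/

section SplitExtension

variable {Γ M : Type u} [Ring Γ] [AddCommGroup M] [Module Γ M] [Module Γᵐᵒᵖ M]
  [SMulCommClass Γ Γᵐᵒᵖ M]

instance : SMulCommClass Γᵐᵒᵖ Γ M := SMulCommClass.symm _ _ _

namespace SplitExtension

variable (θ : BimoduleMul Γ M)

/-- The inclusion `Γ → Γ ⋉_θ M` as a map of left `Γ`-modules. -/
def inlLeft : Γ →ₗ[Γ] SplitExtension θ where
  toFun γ := ⟨γ, 0⟩
  map_add' a b := by ext <;> simp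
  map_smul' a b := by ext <;> simp

/-- The inclusion `Γ → Γ ⋉_θ M` as a map of right `Γ`-modules. -/
def inlRight : Γ →ₗ[Γᵐᵒᵖ] SplitExtension θ where
  toFun γ := ⟨γ, 0⟩
  map_add' a b := by ext <;> simp
  map_smul' a b := by ext <;> simp

/-- The projection `Γ ⋉_θ M → Γ` as a map of left `Γ`-modules. -/
def fstLeft : SplitExtension θ →ₗ[Γ] Γ where
  toFun := fst
  map_add' _ _ := rfl
  map_smul' _ _ := rfl

/-- The projection `Γ ⋉_θ M → Γ` as a map of right `Γ`-modules. -/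
def fstRight : SplitExtension θ →ₗ[Γᵐᵒᵖ] Γ where
  toFun := fst
  map_add' _ _ := rfl
  map_smul' _ _ := rfl

/-- The inclusion `M → Γ ⋉_θ M` as a map of left `Γ`-modules. -/
def inrLeft : M →ₗ[Γ] SplitExtension θ where
  toFun m := ⟨0, m⟩
  map_add' a b := by ext <;> simp
  map_smul' a b := by ext <;> simp

/-- The inclusion `M → Γ ⋉_θ M` as a map of right `Γ`-modules. -/
def inrRight : M →ₗ[Γᵐᵒᵖ] SplitExtension θ where
  toFun m := ⟨0, m⟩
  map_add' a b := by ext <;> simp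
  map_smul' a b := by ext <;> simp

/-- The projection `Γ ⋉_θ M → M` as a map of left `Γ`-modules. -/
def sndLeft : SplitExtension θ →ₗ[Γ] M where
  toFun := snd
  map_add' _ _ := rfl
  map_smul' _ _ := by simp

/-- The projection `Γ ⋉_θ M → M` as a map of right `Γ`-modules. -/
def sndRight : SplitExtension θ →ₗ[Γᵐᵒᵖ] M where
  toFun := snd
  map_add' _ _ := rfl
  map_smul' _ _ := by simp

@[simp] theorem inlLeft_apply (a : Γ) : inlLeft θ a = ⟨a, 0⟩ := rfl
@[simp] theorem fstLeft_apply (a : SplitExtension θ) : fstLeft θ a = a.fst := rfl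
@[simp] theorem inrLeft_apply (a : M) : inrLeft θ a = ⟨0, a⟩ := rfl
@[simp] theorem sndLeft_apply (a : SplitExtension θ) : sndLeft θ a = a.snd := rfl
@[simp] theorem inlRight_apply (a : Γ) : inlRight θ a = ⟨a, 0⟩ := rfl
@[simp] theorem fstRight_apply (a : SplitExtension θ) : fstRight θ a = a.fst := rfl
@[simp] theorem inrRight_apply (a : M) : inrRight θ a = ⟨0, a⟩ := rfl
@[simp] theorem sndRight_apply (a : SplitExtension θ) : sndRight θ a = a.snd := rfl

theorem decomp_left :
    inlLeft θ ∘ₗ fstLeft θ + inrLeft θ ∘ₗ sndLeft θ = .id := by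
  ext a <;> simp

theorem decomp_right :
    inlRight θ ∘ₗ fstRight θ + inrRight θ ∘ₗ sndRight θ = .id := by
  ext a <;> simp

section Right

variable {θ} {X : Type u} [AddCommGroup X] [Module (SplitExtension θ)ᵐᵒᵖ X] [Module Γᵐᵒᵖ X]

/-- The action map `X ⊗_Γ (Γ ⋉ M) → X` of a right module. -/
def actRight (hX : ∀ (γ : Γ) (x : X), op γ • x = op (inl θ γ) • x) :
    TensR Γ (SplitExtension θ)ᵐᵒᵖ X (SplitExtension θ) →ₗ[(SplitExtension θ)ᵐᵒᵖ] X :=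
  TensR.mkLinear (RTensor.lift Γ
    (AddMonoidHom.mk' (fun x => AddMonoidHom.mk' (fun e => op e • x)
      (fun a b => by simp [add_smul])) (fun x y => by ext; simp))
    (fun x γ e => by simp [hX, smul_eq, mul_smul]))
    (fun s x e => mul_smul s (op e) x)

variable (θ X) in
/-- The map `1 ⊗ pr : X ⊗_Γ (Γ ⋉ M) → X ⊗_Γ M`. -/
abbrev prRight : RTensor Γ X (SplitExtension θ) →+ RTensor Γ X M :=
  RTensor.map Γ .id (sndLeft θ)

variable (θ X) in
/-- The map `1 ⊗ in : X ⊗_Γ M → X ⊗_Γ (Γ ⋉ M)`. -/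
abbrev inRight : RTensor Γ X M →+ RTensor Γ X (SplitExtension θ) :=
  RTensor.map Γ .id (inrLeft θ)

/-- On `x ⊗ (γ, m)` this is `x ⊗ (γ, m) = xγ ⊗ 1 + x ⊗ (0, m)` with `xγ = x(γ, m) - x(0, m)`. It
shows that an element is determined by its image under the action and its component in `X ⊗_Γ M`. -/
theorem eq_actRight_add (hX : ∀ (γ : Γ) (x : X), op γ • x = op (inl θ γ) • x)
    (t : RTensor Γ X (SplitExtension θ)) :
    t = RTensor.tmul Γ (actRight hX t) 1 -
      RTensor.tmul Γ (actRight hX (inRight θ X (prRight θ X t))) 1 +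
        inRight θ X (prRight θ X t) := by
  let T := RTensor.tmulHomFlip Γ (X := X) (1 : SplitExtension θ)
  let A : RTensor Γ X (SplitExtension θ) →+ X := (actRight hX).toAddMonoidHom
  have h : AddMonoidHom.id _ = T.comp A - T.comp (A.comp ((inRight θ X).comp (prRight θ X))) +
      (inRight θ X).comp (prRight θ X) := by
    refine RTensor.hom_ext Γ fun x e => ?_
    change RTensor.tmul Γ x e = RTensor.tmul Γ (op e • x) 1 -
      RTensor.tmul Γ (op (inrLeft θ (sndLeft θ e)) • x) 1 +
      RTensor.tmul Γ x (inrLeft θ (sndLeft θ e))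
    have h1 : e = inl θ e.fst + inrLeft θ (sndLeft θ e) := by
      ext <;> simp
    have h2 : op e • x = op e.fst • x + op (inrLeft θ (sndLeft θ e)) • x := by
      rw [hX, ← add_smul, ← MulOpposite.op_add, ← h1]
    rw [h2, RTensor.add_tmul, add_sub_cancel_right, RTensor.smul_tmul, ← RTensor.tmul_add]
    congr 1
    rw [smul_eq, mul_one]
    exact h1
  exact DFunLike.congr_fun h t

/-- The kernel of the action map `X ⊗_Γ (Γ ⋉ M) → X` is `X ⊗_Γ M` as a `Γ`-module. -/
theorem exists_equiv_ker_actRight (hX : ∀ (γ : Γ) (x : X), op γ • x = op (inl θ γ) • x)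
    [Module Γᵐᵒᵖ (LinearMap.ker (actRight hX))]
    (hK : ∀ (γ : Γ) (x : LinearMap.ker (actRight hX)), op γ • x = op (inl θ γ) • x) :
    Nonempty (LinearMap.ker (actRight hX) ≃ₗ[Γᵐᵒᵖ] RTensor Γ X M) := by
  have hpr : ∀ (γ : Γᵐᵒᵖ) (t : TensR Γ (SplitExtension θ)ᵐᵒᵖ X (SplitExtension θ)),
      prRight θ X (op (inl θ γ.unop) • t) = γ • prRight θ X t := fun γ t => by
    have : (prRight θ X).comp (TensR.action Γ (SplitExtension θ)ᵐᵒᵖ (SplitExtension θ)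
        (op (inl θ γ.unop))) = AddMonoidHom.comp (RTensor.rightAction Γ γ) (prRight θ X) :=
      RTensor.hom_ext Γ fun x e => congrArg (RTensor.tmul Γ x) (snd_op_smul γ e)
    exact DFunLike.congr_fun this t
  let F : LinearMap.ker (actRight hX) →ₗ[Γᵐᵒᵖ] RTensor Γ X M :=
    { toFun := fun k => prRight θ X k.1
      map_add' := fun a b => map_add (prRight θ X) a.1 b.1
      map_smul' := fun γ k => by
        rw [RingHom.id_apply, ← hpr γ k.1, ← op_unop γ, hK]
        rfl }
  refine ⟨LinearEquiv.ofBijective F ⟨(injective_iff_map_eq_zero _).2 fun k hk => ?_, fun u => ?_⟩⟩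
  · have h1 := eq_actRight_add hX k.1
    have h2 : prRight θ X k.1 = 0 := hk
    have h3 : actRight hX k.1 = 0 := k.2
    have h4 : actRight hX (0 : RTensor Γ X (SplitExtension θ)) = 0 := map_zero (actRight hX)
    rw [h2, map_zero, h3, h4, RTensor.zero_tmul, sub_self, zero_add] at h1
    exact Subtype.ext h1
  · let v : TensR Γ (SplitExtension θ)ᵐᵒᵖ X (SplitExtension θ) := inRight θ X u
    let w : TensR Γ (SplitExtension θ)ᵐᵒᵖ X (SplitExtension θ) :=
      RTensor.tmul Γ (actRight hX v) 1
    -- The lift of `u` to `X ⊗_Γ E` is corrected by an element of the form `x ⊗ 1`, which has no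
    -- component in `X ⊗_Γ M`, so as to be killed by the action.
    refine ⟨⟨v - w, ?_⟩, ?_⟩
    · rw [LinearMap.mem_ker, map_sub, sub_eq_zero]
      exact (one_smul (SplitExtension θ)ᵐᵒᵖ (actRight hX v)).symm
    · change prRight θ X (v - w) = u
      refine (map_sub (prRight θ X) v w).trans ?_
      have h1 : prRight θ X w = 0 := RTensor.tmul_zero Γ _
      have h2 : prRight θ X v = u := by
        refine (RTensor.map_map Γ _ _ _ _ u).trans ?_
        exact DFunLike.congr_fun (RTensor.map_id Γ) u
      exact (congrArg₂ (· - ·) h2 h1).trans (sub_zero u)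

end Right

section Left

variable {θ} {X : Type u} [AddCommGroup X] [Module (SplitExtension θ) X] [Module Γ X]

/-- The action map `(Γ ⋉ M) ⊗_Γ X → X` of a left module. -/
def actLeft (hX : ∀ (γ : Γ) (x : X), γ • x = inl θ γ • x) :
    TensL Γ (SplitExtension θ) (SplitExtension θ) X →ₗ[SplitExtension θ] X :=
  TensL.mkLinear (RTensor.lift Γ
    (AddMonoidHom.mk' (fun e => AddMonoidHom.mk' (fun x => e • x)
      (fun a b => by simp)) (fun x y => by ext; simp [add_smul]))
    (fun e γ x => by simp [hX, op_smul_eq, mul_smul]))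
    (fun s e x => mul_smul s e x)

variable (θ X) in
/-- The map `pr ⊗ 1 : (Γ ⋉ M) ⊗_Γ X → M ⊗_Γ X`. -/
abbrev prLeft : RTensor Γ (SplitExtension θ) X →+ RTensor Γ M X :=
  RTensor.map Γ (sndRight θ) .id

variable (θ X) in
/-- The map `in ⊗ 1 : M ⊗_Γ X → (Γ ⋉ M) ⊗_Γ X`. -/
abbrev inLeft : RTensor Γ M X →+ RTensor Γ (SplitExtension θ) X :=
  RTensor.map Γ (inrRight θ) .id

theorem eq_actLeft_add (hX : ∀ (γ : Γ) (x : X), γ • x = inl θ γ • x)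
    (t : RTensor Γ (SplitExtension θ) X) :
    t = RTensor.tmul Γ 1 (actLeft hX t) -
      RTensor.tmul Γ 1 (actLeft hX (inLeft θ X (prLeft θ X t))) +
        inLeft θ X (prLeft θ X t) := by
  let T := RTensor.tmulHom Γ (Y := X) (1 : SplitExtension θ)
  let A : RTensor Γ (SplitExtension θ) X →+ X := (actLeft hX).toAddMonoidHom
  have h : AddMonoidHom.id _ = T.comp A - T.comp (A.comp ((inLeft θ X).comp (prLeft θ X))) +
      (inLeft θ X).comp (prLeft θ X) := by
    refine RTensor.hom_ext Γ fun e x => ?_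
    change RTensor.tmul Γ e x = RTensor.tmul Γ 1 (e • x) -
      RTensor.tmul Γ 1 (inrRight θ (sndRight θ e) • x) +
      RTensor.tmul Γ (inrRight θ (sndRight θ e)) x
    have h1 : e = inl θ e.fst + inrRight θ (sndRight θ e) := by
      ext <;> simp
    have h2 : e • x = e.fst • x + inrRight θ (sndRight θ e) • x := by
      rw [hX, ← add_smul, ← h1]
    rw [h2, RTensor.tmul_add, add_sub_cancel_right, ← RTensor.smul_tmul, ← RTensor.add_tmul]
    congr 1
    rw [op_smul_eq, one_mul]
    exact h1
  exact DFunLike.congr_fun h t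

/-- The kernel of the action map `(Γ ⋉ M) ⊗_Γ X → X` is `M ⊗_Γ X` as a `Γ`-module. -/
theorem exists_equiv_ker_actLeft (hX : ∀ (γ : Γ) (x : X), γ • x = inl θ γ • x)
    [Module Γ (LinearMap.ker (actLeft hX))]
    (hK : ∀ (γ : Γ) (x : LinearMap.ker (actLeft hX)), γ • x = inl θ γ • x) :
    Nonempty (LinearMap.ker (actLeft hX) ≃ₗ[Γ] RTensor Γ M X) := by
  have hpr : ∀ (γ : Γ) (t : TensL Γ (SplitExtension θ) (SplitExtension θ) X),
      prLeft θ X (inl θ γ • t) = γ • prLeft θ X t := fun γ t => by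
    have : (prLeft θ X).comp (TensL.action Γ (SplitExtension θ) (SplitExtension θ)
        (inl θ γ)) = AddMonoidHom.comp (RTensor.leftAction Γ γ) (prLeft θ X) :=
      RTensor.hom_ext Γ fun e x => congrArg (RTensor.tmul Γ · x) (snd_smul γ e)
    exact DFunLike.congr_fun this t
  let F : LinearMap.ker (actLeft hX) →ₗ[Γ] RTensor Γ M X :=
    { toFun := fun k => prLeft θ X k.1
      map_add' := fun a b => map_add (prLeft θ X) a.1 b.1
      map_smul' := fun γ k => by
        rw [RingHom.id_apply, ← hpr γ k.1, hK]
        rfl }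
  refine ⟨LinearEquiv.ofBijective F ⟨(injective_iff_map_eq_zero _).2 fun k hk => ?_, fun u => ?_⟩⟩
  · have h1 := eq_actLeft_add hX k.1
    have h2 : prLeft θ X k.1 = 0 := hk
    have h3 : actLeft hX k.1 = 0 := k.2
    have h4 : actLeft hX (0 : RTensor Γ (SplitExtension θ) X) = 0 := map_zero (actLeft hX)
    rw [h2, map_zero, h3, h4, RTensor.tmul_zero, sub_self, zero_add] at h1
    exact Subtype.ext h1
  · let v : TensL Γ (SplitExtension θ) (SplitExtension θ) X := inLeft θ X u
    let w : TensL Γ (SplitExtension θ) (SplitExtension θ) X :=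
      RTensor.tmul Γ 1 (actLeft hX v)
    refine ⟨⟨v - w, ?_⟩, ?_⟩
    · rw [LinearMap.mem_ker, map_sub, sub_eq_zero]
      exact (one_smul (SplitExtension θ) (actLeft hX v)).symm
    · change prLeft θ X (v - w) = u
      refine (map_sub (prLeft θ X) v w).trans ?_
      have h1 : prLeft θ X w = 0 := RTensor.zero_tmul Γ _
      have h2 : prLeft θ X v = u := by
        refine (RTensor.map_map Γ _ _ _ _ u).trans ?_
        exact DFunLike.congr_fun (RTensor.map_id Γ) u
      exact (congrArg₂ (· - ·) h2 h1).trans (sub_zero u)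

end Left

end SplitExtension

end SplitExtension

/-! ### Associativity of the tensor product -/

namespace RTensor

variable (Γ : Type u) [Ring Γ] {X Y Z X' : Type u} [AddCommGroup X] [Module Γᵐᵒᵖ X]
  [AddCommGroup Y] [Module Γ Y] [Module Γᵐᵒᵖ Y] [SMulCommClass Γ Γᵐᵒᵖ Y] [AddCommGroup Z]
  [Module Γ Z] [AddCommGroup X'] [Module Γᵐᵒᵖ X']

theorem hom_ext_right {G : Type*} [AddCommGroup G] {f g : RTensor Γ X (RTensor Γ Y Z) →+ G}
    (h : ∀ x y z, f (tmul Γ x (tmul Γ y z)) = g (tmul Γ x (tmul Γ y z))) : f = g :=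
  hom_ext Γ fun x t => by
    have : f.comp (tmulHom Γ x) = g.comp (tmulHom Γ x) := hom_ext Γ fun y z => h x y z
    exact DFunLike.congr_fun this t

theorem hom_ext_left {G : Type*} [AddCommGroup G] {f g : RTensor Γ (RTensor Γ X Y) Z →+ G}
    (h : ∀ x y z, f (tmul Γ (tmul Γ x y) z) = g (tmul Γ (tmul Γ x y) z)) : f = g :=
  hom_ext Γ fun t z => by
    have : f.comp (tmulHomFlip Γ z) = g.comp (tmulHomFlip Γ z) :=
      hom_ext Γ fun x y => h x y z
    exact DFunLike.congr_fun this t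

variable (X Y Z) in
/-- The associativity map `X ⊗ (Y ⊗ Z) → (X ⊗ Y) ⊗ Z`. -/
def assocHom : RTensor Γ X (RTensor Γ Y Z) →+ RTensor Γ (RTensor Γ X Y) Z :=
  lift Γ (AddMonoidHom.mk'
    (fun x => lift Γ (AddMonoidHom.mk' (fun y => tmulHom Γ (tmul Γ x y))
        (fun y y' => by ext; simp [tmul_add, add_tmul]))
      (fun y γ z => smul_tmul Γ (tmul Γ x y) γ z))
    (fun x x' => hom_ext Γ fun y z =>
      (congrArg (tmul Γ · z) (add_tmul Γ x x' y)).trans (add_tmul Γ _ _ z)))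
    (fun x γ t => by
      induction t using induction_on with
      | zero => simp
      | tmul y z => exact congrArg (tmul Γ · z) (smul_tmul Γ x γ y)
      | add s t hs ht => rw [map_add, hs, ht, smul_add, map_add])

variable (X Y Z) in
/-- The associativity map `(X ⊗ Y) ⊗ Z → X ⊗ (Y ⊗ Z)`. -/
def assocInv : RTensor Γ (RTensor Γ X Y) Z →+ RTensor Γ X (RTensor Γ Y Z) :=
  lift Γ (lift Γ (AddMonoidHom.mk'
    (fun x => AddMonoidHom.mk' (fun y => (tmulHom Γ x).comp (tmulHom Γ y))
        (fun y y' => by ext; simp [tmul_add, add_tmul]))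
    (fun x x' => by ext; simp [add_tmul]))
      (fun x γ y => by ext z; exact smul_tmul Γ x γ (tmul Γ y z)))
    (fun t γ z => by
      induction t using induction_on with
      | zero => simp
      | tmul x y => exact congrArg (tmul Γ x) (smul_tmul Γ y γ z)
      | add s t hs ht => rw [smul_add, map_add, map_add, AddMonoidHom.add_apply, hs, ht]; rfl)

variable (X Y Z) in
/-- The associativity of the tensor product. -/
def assoc : RTensor Γ X (RTensor Γ Y Z) ≃+ RTensor Γ (RTensor Γ X Y) Z where
  __ := assocHom Γ X Y Z
  invFun := assocInv Γ X Y Z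
  left_inv := DFunLike.congr_fun (f := (assocInv Γ X Y Z).comp (assocHom Γ X Y Z))
    (g := AddMonoidHom.id _) (hom_ext_right Γ fun _ _ _ => rfl)
  right_inv := DFunLike.congr_fun (f := (assocHom Γ X Y Z).comp (assocInv Γ X Y Z))
    (g := AddMonoidHom.id _) (hom_ext_left Γ fun _ _ _ => rfl)

theorem assoc_left_smul [Module Γ X] [SMulCommClass Γ Γᵐᵒᵖ X] (γ : Γ)
    (t : RTensor Γ X (RTensor Γ Y Z)) : assoc Γ X Y Z (γ • t) = γ • assoc Γ X Y Z t :=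
  DFunLike.congr_fun (f := (assocHom Γ X Y Z).comp (leftAction Γ γ))
    (g := AddMonoidHom.comp (leftAction Γ γ) (assocHom Γ X Y Z))
    (hom_ext_right Γ fun _ _ _ => rfl) t

theorem assoc_right_smul [Module Γᵐᵒᵖ Z] [SMulCommClass Γ Γᵐᵒᵖ Z] (γ : Γᵐᵒᵖ)
    (t : RTensor Γ X (RTensor Γ Y Z)) : assoc Γ X Y Z (γ • t) = γ • assoc Γ X Y Z t :=
  DFunLike.congr_fun (f := (assocHom Γ X Y Z).comp (rightAction Γ γ))
    (g := AddMonoidHom.comp (rightAction Γ γ) (assocHom Γ X Y Z))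
    (hom_ext_right Γ fun _ _ _ => rfl) t

variable (Y) in
/-- `X ⊗_Γ Y` does not depend on the right module `X` up to isomorphism. -/
def congrLeft (e : X ≃ₗ[Γᵐᵒᵖ] X') : RTensor Γ X Y ≃+ RTensor Γ X' Y where
  __ := map Γ e.toLinearMap .id
  invFun := map Γ e.symm.toLinearMap .id
  left_inv := DFunLike.congr_fun (f := (map Γ e.symm.toLinearMap .id).comp
    (map Γ e.toLinearMap (.id : Y →ₗ[Γ] Y))) (g := AddMonoidHom.id _)
    (hom_ext Γ fun x y => congrArg (tmul Γ · y) (e.symm_apply_apply x))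
  right_inv := DFunLike.congr_fun (f := (map Γ e.toLinearMap .id).comp
    (map Γ e.symm.toLinearMap (.id : Y →ₗ[Γ] Y))) (g := AddMonoidHom.id _)
    (hom_ext Γ fun x y => congrArg (tmul Γ · y) (e.apply_symm_apply x))

end RTensor

/-! ### Tensor powers: both-sided recursion and projective dimension -/

section TensorPow

variable (Γ M : Type u) [Ring Γ] [AddCommGroup M] [Module Γ M] [Module Γᵐᵒᵖ M]
  [SMulCommClass Γ Γᵐᵒᵖ M]

/-- Tensor powers grow on the right by definition, and associativity lets them grow on the left.
Right linearity is carried along so that the induction can tensor the equivalence with `M`. -/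
theorem exists_tensorPow_equiv (j : ℕ) :
    ∃ e : RTensor Γ M (tensorPow Γ M (j + 1)).carrier ≃+ (tensorPow Γ M (j + 2)).carrier,
      (∀ (γ : Γ) t, e (γ • t) = γ • e t) ∧ ∀ (γ : Γᵐᵒᵖ) t, e (γ • t) = γ • e t := by
  induction j with
  | zero => exact ⟨AddEquiv.refl (RTensor Γ M M), fun _ _ => rfl, fun _ _ => rfl⟩
  | succ j ih =>
    obtain ⟨e, hl, hr⟩ := ih
    let e' : RTensor Γ M (tensorPow Γ M (j + 1)).carrier ≃ₗ[Γᵐᵒᵖ]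
        (tensorPow Γ M (j + 2)).carrier := { e with map_smul' := hr }
    let c : RTensor Γ (RTensor Γ M (tensorPow Γ M (j + 1)).carrier) M ≃+
        RTensor Γ (tensorPow Γ M (j + 2)).carrier M := RTensor.congrLeft Γ M e'
    have hcl : ∀ (γ : Γ) t, c (γ • t) = γ • c t := fun γ t =>
      DFunLike.congr_fun (f := c.toAddMonoidHom.comp (RTensor.leftAction Γ γ))
        (g := AddMonoidHom.comp (RTensor.leftAction Γ γ) c.toAddMonoidHom)
        (RTensor.hom_ext Γ fun x y => congrArg (RTensor.tmul Γ · y) (hl γ x)) t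
    have hcr : ∀ (γ : Γᵐᵒᵖ) t, c (γ • t) = γ • c t := fun γ t =>
      DFunLike.congr_fun (f := c.toAddMonoidHom.comp (RTensor.rightAction Γ γ))
        (g := AddMonoidHom.comp (RTensor.rightAction Γ γ) c.toAddMonoidHom)
        (RTensor.hom_ext Γ fun x y => rfl) t
    let a := RTensor.assoc Γ M (tensorPow Γ M (j + 1)).carrier M
    exact ⟨a.trans c,
      fun γ t => (congrArg c (RTensor.assoc_left_smul Γ γ t)).trans (hcl γ (a t)),
      fun γ t => (congrArg c (RTensor.assoc_right_smul Γ γ t)).trans (hcr γ (a t))⟩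

theorem exists_tensorPow_linearEquiv (j : ℕ) :
    Nonempty (RTensor Γ M (tensorPow Γ M (j + 1)).carrier ≃ₗ[Γ]
      (tensorPow Γ M (j + 2)).carrier) := by
  obtain ⟨e, he, -⟩ := exists_tensorPow_equiv Γ M j
  exact ⟨{ e with map_smul' := he }⟩

/-- The two module structures on `X ⊗_Γ M` agree. -/
def TensR.equivRTensor (X : Type u) [AddCommGroup X] [Module Γᵐᵒᵖ X] :
    TensR Γ Γᵐᵒᵖ X M ≃ₗ[Γᵐᵒᵖ] RTensor Γ X M where
  __ := AddEquiv.refl (RTensor Γ X M)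
  map_smul' _ _ := rfl

/-- The two module structures on `M ⊗_Γ X` agree. -/
def TensL.equivRTensor (X : Type u) [AddCommGroup X] [Module Γ X] :
    TensL Γ Γ M X ≃ₗ[Γ] RTensor Γ M X where
  __ := AddEquiv.refl (RTensor Γ M X)
  map_smul' _ _ := rfl

variable {Γ M}

theorem pd_tensorPow_right (hT : ∀ j n, TorVanish Γ n (tensorPow Γ M (j + 1)).carrier M)
    {c : ℕ} (hM : PDLT Γᵐᵒᵖ M (c + 1)) (j : ℕ) :
    ∃ n, PDLT Γᵐᵒᵖ (tensorPow Γ M (j + 1)).carrier (n + 1) := by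
  induction j with
  | zero => exact ⟨c, hM⟩
  | succ j ih =>
    obtain ⟨n, hn⟩ := ih
    exact ⟨n + c, (TensR.pdlt (hT j) hn hM).of_equiv (TensR.equivRTensor Γ M _)⟩

theorem pd_tensorPow_left (hT : ∀ j n, TorVanish Γ n M (tensorPow Γ M (j + 1)).carrier)
    {c : ℕ} (hM : PDLT Γ M (c + 1)) (j : ℕ) :
    ∃ n, PDLT Γ (tensorPow Γ M (j + 1)).carrier (n + 1) := by
  induction j with
  | zero => exact ⟨c, hM⟩
  | succ j ih =>
    obtain ⟨n, hn⟩ := ih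
    obtain ⟨e⟩ := exists_tensorPow_linearEquiv Γ M j
    exact ⟨n + c, (TensL.pdlt (hT j) hn hM).of_equiv ((TensL.equivRTensor Γ M _).trans e)⟩

end TensorPow

/-! ### Finite projective dimension of `0 ⊕ M` and of the comparison bimodules -/

section SplitExtension

variable {Γ M : Type u} [Ring Γ] [AddCommGroup M] [Module Γ M] [Module Γᵐᵒᵖ M]
  [SMulCommClass Γ Γᵐᵒᵖ M] {θ : BimoduleMul Γ M}

namespace SplitExtension

instance : Module.Projective Γᵐᵒᵖ Γ :=
  Module.Projective.of_equiv
    { (opAddEquiv (α := Γ)).symm with map_smul' := fun _ _ => rfl : Γᵐᵒᵖ ≃ₗ[Γᵐᵒᵖ] _ }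

/-- Only the restriction of `X` to `Γ` is prescribed, since the kernel of the action map is
identified only over `Γ`. Here `i` counts the tensor factors missing until the power becomes zero.
-/
theorem exists_pdlt_right (hT : ∀ j n, TorVanish Γ n (tensorPow Γ M (j + 1)).carrier M)
    {c : ℕ} (hM : PDLT Γᵐᵒᵖ M (c + 1)) {N : ℕ} (hN : Subsingleton (tensorPow Γ M N).carrier)
    (i j : ℕ) (hij : j + 1 + i = N) (X : Type u) [AddCommGroup X]
    [Module (SplitExtension θ)ᵐᵒᵖ X] [Module Γᵐᵒᵖ X]
    (hX : ∀ (γ : Γ) (x : X), op γ • x = op (inl θ γ) • x)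
    (e : X ≃ₗ[Γᵐᵒᵖ] (tensorPow Γ M (j + 1)).carrier) :
    ∃ n, PDLT (SplitExtension θ)ᵐᵒᵖ X (n + 1) := by
  induction i generalizing j X with
  | zero =>
    obtain rfl : j + 1 = N := hij
    have := e.toEquiv.subsingleton
    exact ⟨0, PDLT.of_subsingleton⟩
  | succ i ih =>
    let _ : Module Γᵐᵒᵖ (LinearMap.ker (actRight hX)) := Module.compHom _ (inl θ).op
    obtain ⟨e'⟩ := exists_equiv_ker_actRight hX fun _ _ => rfl
    obtain ⟨n, hn⟩ := ih (j + 1) (by lia) (LinearMap.ker (actRight hX)) (fun _ _ => rfl)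
      (e'.trans ((TensR.equivRTensor Γ M X).symm.trans
        ((TensR.congr e).trans (TensR.equivRTensor Γ M _))))
    obtain ⟨m, hm⟩ := pd_tensorPow_right hT hM j
    -- As a left `Γ`-module `E` is `Γ ⊕ M`, so its Tor is controlled by that of `M`.
    have hE : ∀ n, TorVanish Γ n (tensorPow Γ M (j + 1)).carrier (SplitExtension θ) := fun n =>
      TorVanish.of_decomp_right (decomp_left θ) TorVanish.of_projective_right (hT j n)
    have h1 : PDLT (SplitExtension θ)ᵐᵒᵖ
        (TensR Γ (SplitExtension θ)ᵐᵒᵖ X (SplitExtension θ)) (m + 0 + 1) :=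
      (TensR.pdlt (S := (SplitExtension θ)ᵐᵒᵖ) (c := 0) hE hm PDLT.of_projective).of_equiv
        (TensR.congr e).symm
    refine ⟨m + n + 1, PDLT.third (Submodule.injective_subtype (LinearMap.ker (actRight hX)))
      (fun x => ⟨RTensor.tmul Γ x 1, ?_⟩) (LinearMap.exact_subtype_ker_map (actRight hX))
      (hn.mono (by lia)) (h1.mono (by lia))⟩
    exact one_smul (SplitExtension θ)ᵐᵒᵖ x

theorem exists_pdlt_left (hT : ∀ j n, TorVanish Γ n M (tensorPow Γ M (j + 1)).carrier)
    {c : ℕ} (hM : PDLT Γ M (c + 1)) {N : ℕ} (hN : Subsingleton (tensorPow Γ M N).carrier)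
    (i j : ℕ) (hij : j + 1 + i = N) (X : Type u) [AddCommGroup X]
    [Module (SplitExtension θ) X] [Module Γ X]
    (hX : ∀ (γ : Γ) (x : X), γ • x = inl θ γ • x)
    (e : X ≃ₗ[Γ] (tensorPow Γ M (j + 1)).carrier) :
    ∃ n, PDLT (SplitExtension θ) X (n + 1) := by
  induction i generalizing j X with
  | zero =>
    obtain rfl : j + 1 = N := hij
    have := e.toEquiv.subsingleton
    exact ⟨0, PDLT.of_subsingleton⟩
  | succ i ih =>
    let _ : Module Γ (LinearMap.ker (actLeft hX)) := Module.compHom _ (inl θ)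
    obtain ⟨e'⟩ := exists_equiv_ker_actLeft hX fun _ _ => rfl
    obtain ⟨a⟩ := exists_tensorPow_linearEquiv Γ M j
    obtain ⟨n, hn⟩ := ih (j + 1) (by lia) (LinearMap.ker (actLeft hX)) (fun _ _ => rfl)
      (e'.trans ((TensL.equivRTensor Γ M X).symm.trans
        ((TensL.congr e).trans ((TensL.equivRTensor Γ M _).trans a))))
    obtain ⟨m, hm⟩ := pd_tensorPow_left hT hM j
    -- Now `E = Γ ⊕ M` as a right module, whose summand `Γ` is projective.
    have hE : ∀ n, TorVanish Γ n (SplitExtension θ) (tensorPow Γ M (j + 1)).carrier := fun n =>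
      TorVanish.of_decomp_left (decomp_right θ)
        (TorVanish.of_pdlt n.zero_le (PDLT.of_projective (n := 0))) (hT j n)
    have h1 : PDLT (SplitExtension θ)
        (TensL Γ (SplitExtension θ) (SplitExtension θ) X) (m + 0 + 1) :=
      (TensL.pdlt (S := SplitExtension θ) (c := 0) hE hm PDLT.of_projective).of_equiv
        (TensL.congr e).symm
    refine ⟨m + n + 1, PDLT.third (Submodule.injective_subtype (LinearMap.ker (actLeft hX)))
      (fun x => ⟨RTensor.tmul Γ 1 x, ?_⟩) (LinearMap.exact_subtype_ker_map (actLeft hX))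
      (hn.mono (by lia)) (h1.mono (by lia))⟩
    exact one_smul (SplitExtension θ) x

theorem rightKerPD_lt_top (h : IsRightPerfect Γ M) (hnil : IsTensorNilpotent Γ M) :
    rightKerPD θ < ⊤ := by
  obtain ⟨N, hN, hN'⟩ := hnil
  obtain ⟨c, hc⟩ := PDLT.lt_top_iff.1 h.2
  let _ : Module Γᵐᵒᵖ (rightKer θ) := Module.compHom _ (inl θ).op
  let e : rightKer θ ≃ₗ[Γᵐᵒᵖ] M :=
    { toFun := fun a => a.1.snd
      map_add' := fun _ _ => rfl
      map_smul' := fun γ a => snd_op_smul γ a.1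
      invFun := fun m => ⟨⟨0, m⟩, rfl⟩
      left_inv := fun a => Subtype.ext (SplitExtension.ext a.2.symm rfl)
      right_inv := fun _ => rfl }
  -- The iteration starts at the first tensor power, as `0 ⊕ M` restricts to `M`; then `N - 1` steps
  -- reach the zero power.
  exact PDLT.lt_top_iff.2 (exists_pdlt_right
    (fun j => TorVanish.of_isZero_torGroup Γ fun i hi => h.1 i (j + 1) hi (by lia)) hc hN'
    (N - 1) 0 (by lia) (rightKer θ) (fun _ _ => rfl) e)

theorem leftKerPD_lt_top (h : IsLeftPerfect Γ M) (hnil : IsTensorNilpotent Γ M) :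
    leftKerPD θ < ⊤ := by
  obtain ⟨N, hN, hN'⟩ := hnil
  obtain ⟨c, hc⟩ := PDLT.lt_top_iff.1 h.2
  let _ : Module Γ (leftKer θ) := Module.compHom _ (inl θ)
  let e : leftKer θ ≃ₗ[Γ] M :=
    { toFun := fun a => a.1.snd
      map_add' := fun _ _ => rfl
      map_smul' := fun γ a => snd_smul γ a.1
      invFun := fun m => ⟨⟨0, m⟩, rfl⟩
      left_inv := fun a => Subtype.ext (SplitExtension.ext a.2.symm rfl)
      right_inv := fun _ => rfl }
  exact PDLT.lt_top_iff.2 (exists_pdlt_left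
    (fun j => TorVanish.of_isZero_torGroup Γ fun i hi => h.1 i (j + 1) hi (by lia)) hc hN'
    (N - 1) 0 (by lia) (leftKer θ) (fun _ _ => rfl) e)

/-- From the sequence `0 → 0 ⊕ M → E → Γ → 0` of right `E`-modules with free middle term. -/
theorem pd_right_base_lt_top (h : rightKerPD θ < ⊤) :
    projectiveDimension (ModuleCat.of (SplitExtension θ)ᵐᵒᵖ Γ) < ⊤ := by
  obtain ⟨n, hn⟩ := PDLT.lt_top_iff.1 h
  let g : SplitExtension θ →ₗ[(SplitExtension θ)ᵐᵒᵖ] Γ :=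
    { toFun := fst
      map_add' := fun _ _ => rfl
      map_smul' := fun _ _ => rfl }
  exact PDLT.lt_top_iff.2 ⟨n + 1, PDLT.third (Submodule.injective_subtype (rightKer θ)) (g := g)
    (fun γ => ⟨⟨γ, 0⟩, rfl⟩) (fun a => ⟨fun ha => ⟨⟨a, ha⟩, rfl⟩, fun ⟨b, hb⟩ => hb ▸ b.2⟩) hn
    PDLT.of_projective⟩

variable (θ) in
theorem pd_right_self_lt_top (h : projectiveDimension (ModuleCat.of Γᵐᵒᵖ M) < ⊤) :
    projectiveDimension (ModuleCat.of Γᵐᵒᵖ (SplitExtension θ)) < ⊤ := by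
  obtain ⟨n, hn⟩ := PDLT.lt_top_iff.1 h
  refine PDLT.lt_top_iff.2 ⟨n, PDLT.second (f := inrRight θ) (g := fstRight θ)
    (fun a b hab => congrArg snd hab) (fun γ => ⟨⟨γ, 0⟩, rfl⟩) (fun a => ⟨fun ha => ?_, ?_⟩) hn
    PDLT.of_projective⟩
  · exact ⟨a.snd, SplitExtension.ext ha.symm rfl⟩
  · rintro ⟨m, rfl⟩
    rfl

instance [Module.Finite Γ M] : Module.Finite Γ (SplitExtension θ) := by
  refine Module.Finite.of_surjective ((inlLeft θ).coprod (inrLeft θ)) fun a => ⟨(a.1, a.2), ?_⟩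
  ext <;> simp

instance isNoetherianRing [IsNoetherianRing Γ] [Module.Finite Γ M] :
    IsNoetherianRing (SplitExtension θ) := by
  have : IsScalarTower Γ (SplitExtension θ) (SplitExtension θ) :=
    ⟨fun γ a b => mul_assoc (inl θ γ) a b⟩
  exact isNoetherian_of_tower Γ inferInstance

instance : Module.Finite (SplitExtension θ) Γ :=
  Module.Finite.of_surjective
    { toFun := fst, map_add' := fun _ _ => rfl, map_smul' := fun _ _ => rfl :
      SplitExtension θ →ₗ[SplitExtension θ] Γ } fun γ => ⟨⟨γ, 0⟩, rfl⟩

end SplitExtension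

theorem BimoduleMul.isNilpotent_of_isTensorNilpotent (θ : BimoduleMul Γ M)
    (h : IsTensorNilpotent Γ M) : θ.IsNilpotent := by
  obtain ⟨i, hi, hi'⟩ := h
  obtain ⟨r, rfl⟩ := Nat.exists_eq_add_of_lt hi
  have : Subsingleton (tensorPow Γ M (r + 1 + 1)).carrier := by
    rwa [show r + 1 + 1 = 1 + r + 1 by lia]
  exact ⟨r + 1, r.succ_pos, LinearMap.ext fun x => by
    rw [Subsingleton.elim x 0, map_zero, map_zero]⟩

end SplitExtension

theorem theoremD (k : Type v) (Γ M : Type u)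
    [CommRing k] [IsArtinianRing k] [Ring Γ] [Algebra k Γ] [Module.Finite k Γ]
    [AddCommGroup M] [Module Γ M] [Module Γᵐᵒᵖ M] [SMulCommClass Γ Γᵐᵒᵖ M]
    [Module k M] [IsScalarTower k Γ M] [IsScalarTower k Γᵐᵒᵖ M] [Module.Finite k M]
    [Nontrivial M]
    (θ : BimoduleMul Γ M) (hnil : IsTensorNilpotent Γ M)
    (h : IsPerfectBimodule Γ M ∨ (IsRightPerfect Γ M ∧ θ.hom = 0)) :
    θ.IsRemovable ∧
      (littleFinitisticDim (SplitExtension θ) < ⊤ ↔ littleFinitisticDim Γ < ⊤) ∧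
      (bigFinitisticDim (SplitExtension θ) < ⊤ ↔ bigFinitisticDim Γ < ⊤) ∧
      (globalDim (SplitExtension θ) < ⊤ ↔ globalDim Γ < ⊤) := by
  have hθ := θ.isNilpotent_of_isTensorNilpotent hnil
  have hright : IsRightPerfect Γ M := h.elim (fun h => h.2) (fun h => h.1)
  have hR : SplitExtension.rightKerPD θ < ⊤ := SplitExtension.rightKerPD_lt_top hright hnil
  have : IsNoetherianRing Γ := isNoetherian_of_tower k inferInstance
  have : Module.Finite Γ M := Module.Finite.of_restrictScalars_finite k Γ M
  have hE := SplitExtension.reflectsProjective_self (θ := θ)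
  have hE' := SplitExtension.pd_right_self_lt_top θ hright.2
  have hΓ := SplitExtension.reflectsProjective_base hθ
  have hΓ' := SplitExtension.pd_right_base_lt_top hR
  refine ⟨?_, ⟨hE.littleFinitisticDim_lt_top hE', hΓ.littleFinitisticDim_lt_top hΓ'⟩,
    ⟨hE.bigFinitisticDim_lt_top hE', hΓ.bigFinitisticDim_lt_top hΓ'⟩,
    ⟨hE.globalDim_lt_top hE', hΓ.globalDim_lt_top hΓ'⟩⟩
  rcases h with h | h
  · exact Or.inl ⟨hθ, hR, SplitExtension.leftKerPD_lt_top h.1 hnil⟩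
  -- Without left perfectness the left dimension may be finite or infinite; with `θ = 0` either
  -- outcome is a case of removability.
  · by_cases hL : SplitExtension.leftKerPD θ < ⊤
    · exact Or.inl ⟨hθ, hR, hL⟩
    · exact Or.inr ⟨hθ, hR, hL, h.2⟩
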